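/- **Theorem 2 (Fedosov differential).** Let $M$ be a smooth real (Hausdorff) manifold of dimension $d$ and let $\nabla$ be a smooth torsion-free affine connection on $M$ with Christoffel symbols $\Gamma^k_{ij}$ and Riemann curvature tensor $(R_{ij})^k{}_l$, given by $R(X,Y)Z=\nabla_X\nabla_YZ-\nabla_Y\nabla_XZ-\nabla_{[X,Y]}Z$. *Bundles.* Let $\mathcal SM$ be the bundle of formally completed symmetric algebras of $T^*M$: its sections are the infinite collections of symmetric covariant tensors, written as formal power series $a=\sum_{p\ge0}a_{i_1\dots i_p}(x)\,y^{i_1}\cdots y^{i_p}$, and they form a commutative algebra. For $k\ge-1$ let $\mathcal T^k_{poly}$ be the bundle of formal fiberwise polyvector fields, whose sections are the $C^\infty(M)$-multilinear alternating operators from $k+1$ sections of $\mathcal SM$ to sections of $\mathcal SM$ of the form $\sum_{p}\mathfrak v^{j_0\dots j_k}_{i_1\dots i_p}(x)\,y^{i_1}\cdots y^{i_p}\,\partial_{y^{j_0}}\wedge\dots\wedge\partial_{y^{j_k}}$. Let $\mathcal D^k_{poly}$ be the bundle of formal fiberwise polydifferential operators, whose sections are the $C^\infty(M)$-multilinear operators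 of the form $\sum_{\alpha_0,\dots,\alpha_k}\sum_p\mathfrak P^{\alpha_0\dots\alpha_k}_{i_1\dots i_p}(x)\,y^{i_1}\cdots y^{i_p}\,\partial_{y}^{\alpha_0}\otimes\dots\otimes\partial_{y}^{\alpha_k}$ whose sum over the multi-indices $\alpha$ is finite. In particular $\mathcal T^{-1}_{poly}=\mathcal D^{-1}_{poly}=\mathcal SM$, and sections of $\mathcal T^0_{poly}\subset\mathcal D^0_{poly}$ are formal fiberwise vector fields. $\Omega^q(M,\mathcal B)$ denotes the exterior $q$-forms with values in $\mathcal B$, and $[\cdot,\cdot]$ is the fiberwise Schouten--Nijenhuis bracket on $\Omega(M,\mathcal T_{poly})$, resp. the fiberwise Gerstenhaber bracket on $\Omega(M,\mathcal D_{poly})$. *Operators.* On $\Omega(M,\mathcal SM)$ put $$\delta=dx^i\frac{\partial}{\partial y^i},\qquad \nabla=dx^i\frac{\partial}{\partial x^i}+\Gamma,\qquad \Gamma=-dx^i\,\Gamma^k_{ij}\,y^j\frac{\partial}{\partial y^k},$$ and on $\Omega(M,\mathcal T_{poly})$ and $\Omega(M,\mathcal D_{poly})$ put $\delta=[dx^i\frac{\partial}{\partial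 y^i},\cdot\,]$ and $\nabla=dx^i\frac{\partial}{\partial x^i}+[\Gamma,\cdot\,]$. Let $$R=-\tfrac12\,dx^i dx^j\,(R_{ij})^k{}_l\,y^l\frac{\partial}{\partial y^k}\in\Omega^2(M,\mathcal T^0_{poly}),\qquad \delta^{-1}a=y^k\, i\Big(\frac{\partial}{\partial x^k}\Big)\int_0^1a(x,ty,t\,dx)\frac{dt}{t}$$ for forms $a$ of positive exterior degree. *Claim.* There is $$A=\sum_{p\ge2}dx^k A^j_{k\,i_1\dots i_p}(x)\,y^{i_1}\cdots y^{i_p}\frac{\partial}{\partial y^j}\in\Omega^1(M,\mathcal T^0_{poly})\subset\Omega^1(M,\mathcal D^0_{poly})$$ with the following properties. 1. For every $A_0\in\Omega^1(M,\mathcal T^0_{poly})$ the iteration $A_{n+1}=\delta^{-1}R+\delta^{-1}\big(\nabla A_n+\tfrac12[A_n,A_n]\big)$ converges to $A$ degree by degree in $y$: for each $p$ the component of $A_n$ of degree $p$ in $y$ equals that of $A$ for all sufficiently large $n$. 2. $A=\delta^{-1}R+\delta^{-1}\big(\nabla A+\tfrac12[A,A]\big)$. 3. $\delta^{-1}A=0$.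 4. The operators $D=\nabla-\delta+A$ on $\Omega(M,\mathcal SM)$ and $D=\nabla-\delta+[A,\cdot\,]$ on $\Omega(M,\mathcal T_{poly})$ and on $\Omega(M,\mathcal D_{poly})$, which raise the exterior degree by one, satisfy $D^2=0$. -/

import Mathlib

open scoped Manifold ContDiff

noncomputable section

namespace Fedosov

/-! ### Formal fibrewise tensors over a module of vector fields

Here `R` plays the role of `C^∞(M)` and `V` that of the `C^∞(M)`-module of smooth vector fields. -/

section Formal

variable {R V N P : Type*} [CommRing R] [Algebra ℝ R] [AddCommGroup V] [Module R V]
  [AddCommGroup N] [Module R N] [AddCommGroup P] [Module R P]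

variable (R V N) in
/-- Symmetric covariant tensors of degree `p` with values in `N`, that is, symmetric `R`-multilinear
maps. An element `m` is thought of as the homogeneous polynomial `y ↦ m (y, …, y)` of degree `p` in
the fibre coordinates `y`; its coefficients are the components `m_{i₁…i_p}`. -/
def SymTensor (p : ℕ) : Submodule R (MultilinearMap R (fun _ : Fin p => V) N) where
  carrier := {m | ∀ σ : Equiv.Perm (Fin p), m.domDomCongr σ = m}
  add_mem' := by
    intro a b ha hb σ
    ext v
    simpa using congrArg₂ (· + ·) (congrArg (fun m => m v) (ha σ)) (congrArg (fun m => m v) (hb σ))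
  zero_mem' := by intro σ; ext v; simp
  smul_mem' := by
    intro c a ha σ
    ext v
    simpa using congrArg (fun m => c • m v) (ha σ)

variable (R V N) in
/-- Formal power series in the fibre coordinates `y` with values in `N`: infinite collections of
symmetric covariant tensors. For `N = R` these are the sections of `𝒮M`; for `N = V` they are the
formal fibrewise vector fields `∑ vʲ_{i₁…i_p}(x) y^{i₁} ⋯ y^{i_p} ∂/∂yʲ`. -/
abbrev Formal : Type _ := ∀ p : ℕ, SymTensor R V N p

instance instAddCommGroupFormal : AddCommGroup (Formal R V N) := inferInstance

instance instModuleFormal : Module R (Formal R V N) := inferInstance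

/-- Symmetrization `(1/n!) ∑_σ m ∘ σ`, the symmetric tensor with the same polynomial
`y ↦ m (y, …, y)`. -/
def symmetrize {n : ℕ} :
    MultilinearMap R (fun _ : Fin n => V) N →ₗ[R] SymTensor R V N n where
  toFun m := ⟨algebraMap ℝ R ((n.factorial : ℝ)⁻¹) • ∑ σ : Equiv.Perm (Fin n), m.domDomCongr σ, by
    intro τ
    ext v
    simp only [MultilinearMap.domDomCongr_apply, smul_apply,
      sum_apply]
    congr 1
    exact Fintype.sum_equiv (Equiv.mulLeft τ) _ _ (fun σ => by simp)⟩
  map_add' a b := by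
    ext v
    simp [Finset.sum_add_distrib]
  map_smul' c a := by
    ext v
    simp only [MultilinearMap.domDomCongr_apply, smul_apply,
      sum_apply, Submodule.coe_smul, RingHom.id_apply, ← Finset.smul_sum]
    rw [smul_comm]

/-- The symmetrization of `(y₁, …, y_{p+r}) ↦ g (f (y₁, …, y_p)) (y_{p+1}, …, y_{p+r})`. -/
def fuse {p r n : ℕ} (h : p + r = n) (g : P →ₗ[R] MultilinearMap R (fun _ : Fin r => V) N)
    (f : MultilinearMap R (fun _ : Fin p => V) P) : SymTensor R V N n :=
  symmetrize ((MultilinearMap.uncurrySum (N := fun _ => V)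
    (g.compMultilinearMap f)).domDomCongr (finSumFinEquiv.trans (finCongr h)))

/-- The derivative `∂/∂y` of a formal series in the direction of the vector field `Z` (constant in
`y`): on the polynomial `y ↦ m (y, …, y)` of degree `p + 1` it is `y ↦ (p + 1) m (Z, y, …, y)`. -/
def dirDeriv : V →ₗ[R] Formal R V N →ₗ[R] Formal R V N :=
  LinearMap.mk₂ R
    (fun Z a p => ⟨(p + 1) • (a (p + 1)).1.curryLeft Z, by
      intro σ
      ext v
      have h := congrArg (fun m => m (Fin.cons Z v))
        ((a (p + 1)).2 (Equiv.Perm.decomposeFin.symm (0, σ)))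
      simp only [MultilinearMap.domDomCongr_apply] at h
      simp only [MultilinearMap.domDomCongr_apply, smul_apply,
        MultilinearMap.curryLeft_apply]
      rw [← h]
      congr 2
      funext i
      refine Fin.cases ?_ (fun j => ?_) i <;> simp⟩)
    (by intro a b c; funext p; ext v; simp only [map_add, smul_add]; rfl)
    (by intro a b c; funext p; ext v; simp only [map_smul]; rw [smul_comm]; rfl)
    (by
      intro a b c; funext p; ext v
      exact smul_add (p + 1) ((b (p + 1)).1 (Fin.cons a v)) ((c (p + 1)).1 (Fin.cons a v)))
    (by
      intro c a b; funext p; ext v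
      exact smul_comm (p + 1) c ((b (p + 1)).1 (Fin.cons a v)))

/-- The product of formal power series in `y`. -/
def mul : Formal R V R →ₗ[R] Formal R V R →ₗ[R] Formal R V R :=
  LinearMap.mk₂ R
    (fun a b n => ∑ i ∈ (Finset.HasAntidiagonal.antidiagonal n).attach,
      fuse (Finset.HasAntidiagonal.mem_antidiagonal.mp i.2)
        (LinearMap.toSpanSingleton R _ (b i.1.2).1) (a i.1.1).1)
    (by
      intro a b c; funext n
      simp only [Pi.add_apply, ← Finset.sum_add_distrib, fuse, ← map_add]
      refine Finset.sum_congr rfl fun i _ => ?_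
      congr 1; ext v; simp)
    (by
      intro a b c; funext n
      simp only [Pi.smul_apply, Finset.smul_sum, fuse, ← map_smul]
      refine Finset.sum_congr rfl fun i _ => ?_
      congr 1; ext v; simp)
    (by
      intro a b c; funext n
      simp only [Pi.add_apply, ← Finset.sum_add_distrib, fuse, ← map_add]
      refine Finset.sum_congr rfl fun i _ => ?_
      congr 1; ext v; simp)
    (by
      intro a b c; funext n
      simp only [Pi.smul_apply, Finset.smul_sum, fuse, ← map_smul]
      refine Finset.sum_congr rfl fun i _ => ?_
      congr 1; ext v; simp [mul_left_comm])

/-- The componentwise action of a formal fibrewise vector field `v = vʲ(x, y) ∂/∂yʲ` on formal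
series: `v · a = vʲ(x, y) ∂a/∂yʲ`. -/
def act : Formal R V V →ₗ[R] Formal R V N →ₗ[R] Formal R V N :=
  LinearMap.mk₂ R
    (fun v a n => ∑ i ∈ (Finset.HasAntidiagonal.antidiagonal n).attach,
      fuse (Finset.HasAntidiagonal.mem_antidiagonal.mp i.2)
        ((i.1.2 + 1) • (a (i.1.2 + 1)).1.curryLeft) (v i.1.1).1)
    (by
      intro a b c; funext n
      simp only [Pi.add_apply, ← Finset.sum_add_distrib, fuse, ← map_add]
      refine Finset.sum_congr rfl fun i _ => ?_
      congr 1; ext v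
      exact congrArg (fun m : MultilinearMap R (fun _ : Fin i.1.2 => V) N => m _)
        (map_add ((i.1.2 + 1) • (c (i.1.2 + 1)).1.curryLeft) _ _))
    (by
      intro a b c; funext n
      simp only [Pi.smul_apply, Finset.smul_sum, fuse, ← map_smul]
      refine Finset.sum_congr rfl fun i _ => ?_
      congr 1; ext v
      exact congrArg (fun m : MultilinearMap R (fun _ : Fin i.1.2 => V) N => m _)
        (map_smul ((i.1.2 + 1) • (c (i.1.2 + 1)).1.curryLeft) _ _))
    (by
      intro a b c; funext n
      simp only [Pi.add_apply, ← Finset.sum_add_distrib, fuse, ← map_add]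
      refine Finset.sum_congr rfl fun i _ => ?_
      congr 1; ext v
      exact smul_add (i.1.2 + 1) _ _)
    (by
      intro a b c; funext n
      simp only [Pi.smul_apply, Finset.smul_sum, fuse, ← map_smul]
      refine Finset.sum_congr rfl fun i _ => ?_
      congr 1; ext v
      exact smul_comm (i.1.2 + 1) _ _)

/-- The Lie bracket of formal fibrewise vector fields, `[v, w] = v · w - w · v`. -/
def lie : Formal R V V →ₗ[R] Formal R V V →ₗ[R] Formal R V V :=
  LinearMap.mk₂ R (fun v w => act v w - act w v)
    (by intro u v w; simp only [map_add, LinearMap.add_apply]; abel)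
    (by intro c v w; simp only [map_smul, LinearMap.smul_apply, smul_sub])
    (by intro u v w; simp only [map_add, LinearMap.add_apply]; abel)
    (by intro c v w; simp only [map_smul, LinearMap.smul_apply, smul_sub])

/-- The formal fibrewise vector field `y ↦ T y`, homogeneous of degree `1` in `y`. -/
def linearField : (V →ₗ[R] V) →ₗ[R] Formal R V V where
  toFun T
    | 1 => ⟨MultilinearMap.ofSubsingleton R V V (0 : Fin 1) T, by
        intro σ
        rw [Subsingleton.elim σ 1]
        rfl⟩
    | 0 => 0
    | _ + 2 => 0
  map_add' S T := by
    funext p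
    match p with
    | 1 => rfl
    | 0 => exact (add_zero 0).symm
    | _ + 2 => exact (add_zero 0).symm
  map_smul' f T := by
    funext p
    match p with
    | 1 => rfl
    | 0 => exact (smul_zero f).symm
    | _ + 2 => exact (smul_zero f).symm

end Formal

/-! ### Operators on formal power series -/

section Operators

variable {R V : Type*} [CommRing R] [Algebra ℝ R] [AddCommGroup V] [Module R V]

variable (R V) in
/-- `R`-multilinear operators with `n` arguments on sections of `𝒮M`, with values in sections of
`𝒮M`. For `n = 0` these are the sections of `𝒮M`. -/
abbrev Op (n : ℕ) : Type _ := MultilinearMap R (fun _ : Fin n => Formal R V R) (Formal R V R)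

instance instAddCommGroupOp {n : ℕ} : AddCommGroup (Op R V n) := inferInstance

instance instModuleOp {n : ℕ} : Module R (Op R V n) := inferInstance

/-- The operator `(a₁, …, aₙ) ↦ Φ (a₁, …, T aᵢ, …, aₙ)`. -/
def insertAt {n : ℕ} (i : Fin n) (T : Formal R V R →ₗ[R] Formal R V R) (Φ : Op R V n) : Op R V n :=
  Φ.compLinearMap (Function.update (fun _ => LinearMap.id) i T)

lemma insertAt_apply {n : ℕ} (i : Fin n) (T : Formal R V R →ₗ[R] Formal R V R) (Φ : Op R V n)
    (a : Fin n → Formal R V R) : insertAt i T Φ a = Φ (Function.update a i (T (a i))) := by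
  simp only [insertAt, MultilinearMap.compLinearMap_apply]
  congr 1
  funext j
  by_cases h : j = i
  · subst h; simp
  · simp [h]

/-- The bracket `[T, Φ](a₁, …, aₙ) = T (Φ (a₁, …, aₙ)) - ∑ᵢ Φ (a₁, …, T aᵢ, …, aₙ)` of an operator
`T` with one argument and an operator `Φ` with `n` arguments (the Gerstenhaber bracket and, when `T`
is a vector field and `Φ` a polyvector field, the Schouten–Nijenhuis bracket). -/
def opBracket {n : ℕ} :
    (Formal R V R →ₗ[R] Formal R V R) →ₗ[R] Op R V n →ₗ[R] Op R V n :=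
  LinearMap.mk₂ R (fun T Φ => T.compMultilinearMap Φ - ∑ i, insertAt i T Φ)
    (by
      intro S T Φ; ext1 a
      simp only [sub_apply, add_apply, sum_apply, insertAt_apply, LinearMap.add_apply,
        LinearMap.compMultilinearMap_apply, MultilinearMap.map_update_add, Finset.sum_add_distrib]
      abel)
    (by
      intro c T Φ; ext1 a
      simp only [sub_apply, smul_apply, sum_apply, insertAt_apply, LinearMap.smul_apply,
        LinearMap.compMultilinearMap_apply, MultilinearMap.map_update_smul, Finset.smul_sum,
        smul_sub])
    (by
      intro T Φ Ψ; ext1 a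
      simp only [sub_apply, add_apply, sum_apply, insertAt_apply,
        LinearMap.compMultilinearMap_apply, Finset.sum_add_distrib, map_add]
      abel)
    (by
      intro c T Φ; ext1 a
      simp only [sub_apply, smul_apply, sum_apply, insertAt_apply,
        LinearMap.compMultilinearMap_apply, Finset.smul_sum, smul_sub, map_smul])

variable (R V) in
/-- Sections of the bundle of formal fibrewise polyvector fields with `n` antisymmetric
contravariant indices (degree `n - 1`), as operators: the alternating `R`-multilinear operators that
are derivations of the algebra of sections of `𝒮M` in each argument. -/
def PolyVector (n : ℕ) : Set (Op R V n) :=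
  {Φ | (∀ a i j, i ≠ j → a i = a j → Φ a = 0) ∧
    ∀ a i b c, Φ (Function.update a i (mul b c)) =
      mul b (Φ (Function.update a i c)) + mul c (Φ (Function.update a i b))}

/-- The commutator of `Φ` with the multiplication by `c` in the argument `i`:
`(a₁, …, aₙ) ↦ Φ (a₁, …, c aᵢ, …, aₙ) - c Φ (a₁, …, aₙ)`. -/
def mulCommutator {n : ℕ} (i : Fin n) (c : Formal R V R) (Φ : Op R V n) : Op R V n :=
  insertAt i (mul c) Φ - (mul c).compMultilinearMap Φ

/-- `Φ` is a differential operator of order less than `m` in its argument `i`, relative to the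
base `R`: every `m`-fold iterated commutator with multiplications in that argument vanishes. -/
def OrderLT {n : ℕ} (i : Fin n) : ℕ → Op R V n → Prop
  | 0, Φ => Φ = 0
  | m + 1, Φ => ∀ c, OrderLT i m (mulCommutator i c Φ)

variable (R V) in
/-- Sections of the bundle of formal fibrewise polydifferential operators with `n` arguments
(degree `n - 1`): the `R`-multilinear operators on sections of `𝒮M` that are differential operators
(in the `y` variables) of finite order in each argument. -/
def PolyDiffOp (n : ℕ) : Set (Op R V n) :=
  {Φ | ∃ m, ∀ i, OrderLT i m Φ}

end Operators

/-! ### Exterior forms and connections -/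

section Forms

variable {R V B W N : Type*} [CommRing R] [Algebra ℝ R] [AddCommGroup V] [Module R V]
  [AddCommGroup B] [Module R B] [AddCommGroup W] [Module R W] [AddCommGroup N] [Module R N]

variable (R V B) in
/-- Exterior `q`-forms with values in `B`. -/
abbrev Form (q : ℕ) : Type _ := V [⋀^Fin q]→ₗ[R] B

instance instAddCommGroupForm {q : ℕ} : AddCommGroup (Form R V B q) := inferInstance

instance instModuleForm {q : ℕ} : Module R (Form R V B q) := inferInstance

/-- For `L = L_i dxⁱ` a one-form with values in endomorphisms of `B`, the operator
`dxⁱ L_i` on `B`-valued forms: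
`(X₀, …, X_q) ↦ ∑ᵢ (-1)ⁱ L_{Xᵢ} (η (X₀, …, X̂ᵢ, …, X_q))`. -/
def wedge {q : ℕ} (L : V →ₗ[R] B →ₗ[R] B) (η : Form R V B q) : Form R V B (q + 1) :=
  AlternatingMap.alternatizeUncurryFin
    { toFun := fun X => (L X).compAlternatingMap η
      map_add' := by intro a b; ext v; simp
      map_smul' := by intro a b; ext v; simp }

/-- The differential `δ = dxⁱ ∂/∂yⁱ` on forms with values in formal series. -/
def delta {q : ℕ} (η : Form R V (Formal R V N) q) : Form R V (Formal R V N) (q + 1) :=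
  wedge dirDeriv η

/-- The operator `δ = [dxⁱ ∂/∂yⁱ, · ]` on forms with values in operators. -/
def deltaOp {n q : ℕ} (Φ : Form R V (Op R V n) q) : Form R V (Op R V n) (q + 1) :=
  wedge (opBracket ∘ₗ dirDeriv) Φ

/-- A one-form, as a linear map on vector fields. -/
def oneForm (A : Form R V B 1) : V →ₗ[R] B :=
  (AlternatingMap.ofSubsingleton R V B (0 : Fin 1)).symm A

/-- The action `a ↦ A · a` of a one-form with values in formal fibrewise vector fields on forms with
values in `𝒮M`. -/
def actForm {q : ℕ} (A : Form R V (Formal R V V) 1) (a : Form R V (Formal R V R) q) :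
    Form R V (Formal R V R) (q + 1) :=
  wedge (act ∘ₗ oneForm A) a

/-- The bracket `[A, w]` of a one-form `A` and a form `w`, both with values in formal fibrewise
vector fields. -/
def lieForm {q : ℕ} (A : Form R V (Formal R V V) 1) (w : Form R V (Formal R V V) q) :
    Form R V (Formal R V V) (q + 1) :=
  wedge (lie ∘ₗ oneForm A) w

/-- The bracket `[A, Φ]` of a one-form `A` with values in formal fibrewise vector fields and a form
`Φ` with values in operators. -/
def bracketForm {n q : ℕ} (A : Form R V (Formal R V V) 1) (Φ : Form R V (Op R V n) q) :
    Form R V (Op R V n) (q + 1) :=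
  wedge (opBracket ∘ₗ act ∘ₗ oneForm A) Φ

/-- The operator `δ⁻¹ a = yᵏ i(∂/∂xᵏ) ∫₀¹ a(x, t y, t dx) dt/t` on forms of positive degree: on the
component of degree `p` in `y` and degree `q + 1` in `dx` it is the operator `yᵏ i(∂/∂xᵏ)`
divided by `p + q + 1`. -/
def deltaInv {q : ℕ} (η : Form R V (Formal R V N) (q + 1)) : Form R V (Formal R V N) q where
  toFun X
    | 0 => 0
    | p + 1 => algebraMap ℝ R (((p + q + 1 : ℕ) : ℝ)⁻¹) • symmetrize (LinearMap.uncurryLeft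
        { toFun := fun Y => (η.curryLeft Y X p).1
          map_add' := by intro Y Z; simp
          map_smul' := by intro f Y; simp })
  map_update_add' := by
    intro _ X i Y Z
    funext p
    cases p with
    | zero => simp
    | succ p =>
      rw [Pi.add_apply, ← smul_add, ← map_add]
      refine congrArg (fun m => _ • symmetrize m) ?_
      ext v
      simp
  map_update_smul' := by
    intro _ X i f Y
    funext p
    cases p with
    | zero => simp
    | succ p =>
      rw [Pi.smul_apply, smul_comm, ← map_smul]
      refine congrArg (fun m => _ • symmetrize m) ?_
      ext v
      simp
  map_eq_zero_of_eq' := by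
    intro X i j h hij
    funext p
    cases p with
    | zero => rfl
    | succ p =>
      refine (congrArg (fun m => _ • symmetrize m) ?_).trans
        ((congrArg _ (map_zero symmetrize)).trans (smul_zero _))
      ext v
      simp [AlternatingMap.map_eq_zero_of_eq _ X h hij]

/-- A connection on the `R`-module `B` (sections of a vector bundle), where `dir X f = X f` is the
action of vector fields on functions. -/
structure Connection (dir : V →ₗ[R] Derivation ℝ R R) (B : Type*) [AddCommGroup B] [Module R B] where
  /-- The covariant derivative `∇_X b`. -/
  toFun : V → B → B
  add_left : ∀ X Y b, toFun (X + Y) b = toFun X b + toFun Y b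
  smul_left : ∀ (f : R) X b, toFun (f • X) b = f • toFun X b
  add_right : ∀ X b c, toFun X (b + c) = toFun X b + toFun X c
  leibniz : ∀ X (f : R) b, toFun X (f • b) = f • toFun X b + dir X f • b

namespace Connection

variable {dir : V →ₗ[R] Derivation ℝ R R}

lemma zero_right (c : Connection dir B) (X : V) : c.toFun X 0 = 0 := by
  simpa using c.add_right X 0 0

variable (dir) in
/-- The derivative of functions. -/
def trivial : Connection dir R where
  toFun X f := dir X f
  add_left := by intros; simp
  smul_left := by intros; simp
  add_right := by intros; simp
  leibniz := by intros; simp [mul_comm]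

/-- The induced connection on multilinear maps:
`(∇_X m)(w₁, …, wₙ) = ∇_X (m (w₁, …, wₙ)) - ∑ᵢ m (w₁, …, ∇_X wᵢ, …, wₙ)`. -/
def multilinear (cW : Connection dir W) (cN : Connection dir N) (n : ℕ) :
    Connection dir (MultilinearMap R (fun _ : Fin n => W) N) where
  toFun X m := MultilinearMap.mk'
    (fun w => cN.toFun X (m w) - ∑ i, m (Function.update w i (cW.toFun X (w i))))
    (by
      intro w i u u'
      rw [← Finset.add_sum_erase _ _ (Finset.mem_univ i),
        ← Finset.add_sum_erase _ _ (Finset.mem_univ i),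
        ← Finset.add_sum_erase _ _ (Finset.mem_univ i)]
      have h : ∀ j ∈ Finset.univ.erase i, ∀ z : W,
          Function.update (Function.update w i z) j (cW.toFun X (Function.update w i z j)) =
            Function.update (Function.update w j (cW.toFun X (w j))) i z := by
        intro j hj z
        rw [Function.update_of_ne (Finset.ne_of_mem_erase hj),
          Function.update_comm (Finset.ne_of_mem_erase hj).symm]
      rw [Finset.sum_congr rfl fun j hj => congrArg m (h j hj _),
        Finset.sum_congr rfl fun j hj => congrArg m (h j hj u),
        Finset.sum_congr rfl fun j hj => congrArg m (h j hj u')]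
      simp only [MultilinearMap.map_update_add, Function.update_self, Function.update_idem,
        cN.add_right, cW.add_right, Finset.sum_add_distrib]
      abel)
    (by
      intro w i f u
      rw [← Finset.add_sum_erase _ _ (Finset.mem_univ i),
        ← Finset.add_sum_erase _ _ (Finset.mem_univ i)]
      have h : ∀ j ∈ Finset.univ.erase i, ∀ z : W,
          Function.update (Function.update w i z) j (cW.toFun X (Function.update w i z j)) =
            Function.update (Function.update w j (cW.toFun X (w j))) i z := by
        intro j hj z
        rw [Function.update_of_ne (Finset.ne_of_mem_erase hj),
          Function.update_comm (Finset.ne_of_mem_erase hj).symm]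
      rw [Finset.sum_congr rfl fun j hj => congrArg m (h j hj _),
        Finset.sum_congr rfl fun j hj => congrArg m (h j hj u)]
      simp only [MultilinearMap.map_update_add, MultilinearMap.map_update_smul,
        Function.update_self, Function.update_idem, cN.leibniz, cW.leibniz, ← Finset.smul_sum,
        smul_sub, smul_add]
      abel)
  add_left := by intros; ext; simp [cN.add_left, cW.add_left, Finset.sum_add_distrib]; abel
  smul_left := by
    intros; ext; simp [cN.smul_left, cW.smul_left, Finset.smul_sum, smul_sub]
  add_right := by intros; ext; simp [cN.add_right, Finset.sum_add_distrib]; abel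
  leibniz := by
    intros; ext; simp [cN.leibniz, Finset.smul_sum, smul_sub]; abel

/-- The induced connection on formal series. -/
def formal (cV : Connection dir V) (cN : Connection dir N) : Connection dir (Formal R V N) where
  toFun X a p := ⟨(multilinear cV cN p).toFun X (a p).1, by
    intro σ
    ext v
    have h : ∀ v : Fin p → V, (a p).1 (v ∘ σ) = (a p).1 v :=
      fun v => congrArg (fun m => m v) ((a p).2 σ)
    change cN.toFun X ((a p).1 (v ∘ σ)) -
      ∑ i, (a p).1 (Function.update (v ∘ σ) i (cV.toFun X (v (σ i)))) =
        cN.toFun X ((a p).1 v) - ∑ i, (a p).1 (Function.update v i (cV.toFun X (v i)))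
    rw [h]
    congr 1
    refine Fintype.sum_equiv σ _ _ fun i => ?_
    rw [← h (Function.update v (σ i) _), Function.update_comp_equiv, Equiv.symm_apply_apply]⟩
  add_left := by intros; funext p; ext1; exact (multilinear cV cN p).add_left _ _ _
  smul_left := by intros; funext p; ext1; exact (multilinear cV cN p).smul_left _ _ _
  add_right := by intros; funext p; ext1; exact (multilinear cV cN p).add_right _ _ _
  leibniz := by intros; funext p; ext1; exact (multilinear cV cN p).leibniz _ _ _

/-- The induced connection on exterior forms. -/
def form (cV : Connection dir V) (cB : Connection dir B) (q : ℕ) :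
    Connection dir (Form R V B q) where
  toFun X η :=
    { (multilinear cV cB q).toFun X η.toMultilinearMap with
      map_eq_zero_of_eq' := by
        intro v i j h hij
        change cB.toFun X (η v) - ∑ k, η (Function.update v k (cV.toFun X (v k))) = 0
        rw [η.map_eq_zero_of_eq v h hij, cB.zero_right, zero_sub, neg_eq_zero,
          Finset.sum_eq_add i j hij, ← h]
        · have hs : Function.update v j (cV.toFun X (v i)) =
              Function.update v i (cV.toFun X (v i)) ∘ Equiv.swap i j := by
            funext k
            by_cases hk : k = j
            · subst hk; simp
            · by_cases hk' : k = i
              · subst hk'; simp [hk, hij.symm, h]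
              · simp [hk, hk', Equiv.swap_apply_of_ne_of_ne hk' hk]
          rw [hs, η.map_swap _ hij, add_neg_cancel]
        · intro k _ hk
          exact η.map_eq_zero_of_eq _ (by simp [hk.1.symm, hk.2.symm, h]) hij
        · simp
        · simp }
  add_left := by
    intros; apply AlternatingMap.coe_multilinearMap_injective
    exact (multilinear cV cB q).add_left _ _ _
  smul_left := by
    intros; apply AlternatingMap.coe_multilinearMap_injective
    exact (multilinear cV cB q).smul_left _ _ _
  add_right := by
    intros; apply AlternatingMap.coe_multilinearMap_injective
    exact (multilinear cV cB q).add_right _ _ _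
  leibniz := by
    intros; apply AlternatingMap.coe_multilinearMap_injective
    exact (multilinear cV cB q).leibniz _ _ _

/-- The exterior covariant derivative, the antisymmetrization
`(X₀, …, X_q) ↦ ∑ᵢ (-1)ⁱ (∇_{Xᵢ} η)(X₀, …, X̂ᵢ, …, X_q)` of the covariant derivative `∇η`. As the
connection `cV` on vector fields used here will be torsion free, its Christoffel symbols do not
contribute on the indices `X₀, …, X_q`, and the operator is `dxⁱ ∇_i` with `∇_i` acting on the
coefficients in `B` only. -/
def extDeriv (cV : Connection dir V) (cB : Connection dir B) {q : ℕ} (η : Form R V B q) :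
    Form R V B (q + 1) :=
  AlternatingMap.alternatizeUncurryFin
    { toFun := fun X => (form cV cB q).toFun X η
      map_add' := fun X Y => (form cV cB q).add_left X Y η
      map_smul' := fun f X => (form cV cB q).smul_left f X η }

end Connection

end Forms

section Fedosov

variable {R V : Type*} [CommRing R] [Algebra ℝ R] [AddCommGroup V] [Module R V]
  {dir : V →ₗ[R] Derivation ℝ R R} (c : Connection dir V)

/-- The derivation `∇` on forms with values in `𝒮M`. -/
def nabla {q : ℕ} (a : Form R V (Formal R V R) q) :
    Form R V (Formal R V R) (q + 1) :=
  c.extDeriv (c.formal (.trivial dir)) a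

/-- The derivation `∇` on forms with values in formal fibrewise vector fields. -/
def nablaVect {q : ℕ} (a : Form R V (Formal R V V) q) :
    Form R V (Formal R V V) (q + 1) :=
  c.extDeriv (c.formal c) a

/-- The derivation `∇` on forms with values in operators on sections of `𝒮M`. -/
def nablaOp {n q : ℕ} (Φ : Form R V (Op R V n) q) :
    Form R V (Op R V n) (q + 1) :=
  c.extDeriv (Connection.multilinear (c.formal (.trivial dir))
    (c.formal (.trivial dir)) n) Φ

/-- For `K` bilinear and alternating with values in endomorphisms, the two-form
`(X, Y) ↦ (y ↦ -K(X, Y) y)` with values in formal fibrewise vector fields; if `K = (R_{ij})ᵏ_l` is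
the curvature tensor, this is `R = -½ dxⁱ dxʲ (R_{ij})ᵏ_l(x) y^l ∂/∂yᵏ`. -/
def curvatureForm (K : V →ₗ[R] V →ₗ[R] V →ₗ[R] V) (hK : ∀ X, K X X = 0) :
    Form R V (Formal R V V) 2 where
  toFun X := linearField (-K (X 0) (X 1))
  map_update_add' := by
    intro inst X i Y Z
    rw [Subsingleton.elim inst (instDecidableEqFin 2)]
    fin_cases i <;> simp [add_comm]
  map_update_smul' := by
    intro inst X i f Y
    rw [Subsingleton.elim inst (instDecidableEqFin 2)]
    fin_cases i <;> simp
  map_eq_zero_of_eq' := by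
    intro X i j h hij
    have h01 : X 0 = X 1 := by
      fin_cases i <;> fin_cases j <;> simp_all
    rw [h01, hK, neg_zero, map_zero]

/-- The right-hand side `A ↦ δ⁻¹ R + δ⁻¹ (∇ A + ½ [A, A])` of the iteration, where `R` is the
two-form `Rc`. -/
def fedosovStep (Rc : Form R V (Formal R V V) 2)
    (A : Form R V (Formal R V V) 1) :
    Form R V (Formal R V V) 1 :=
  deltaInv Rc +
    deltaInv (nablaVect c A + algebraMap ℝ R (1 / 2) • lieForm A A)

/-- The derivation `D = ∇ - δ + A` on forms with values in `𝒮M`. -/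
def fedosovD {q : ℕ} (A : Form R V (Formal R V V) 1)
    (a : Form R V (Formal R V R) q) :
    Form R V (Formal R V R) (q + 1) :=
  nabla c a - delta a + actForm A a

/-- The derivation `D = ∇ - δ + [A, · ]` on forms with values in operators on sections of `𝒮M`, in
particular on forms with values in polyvector fields or polydifferential operators. -/
def fedosovDOp {n q : ℕ} (A : Form R V (Formal R V V) 1)
    (Φ : Form R V (Op R V n) q) :
    Form R V (Op R V n) (q + 1) :=
  nablaOp c Φ - deltaOp Φ + bracketForm A Φ

end Fedosov

/-! ### Vector fields, connections and curvature on a manifold -/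

section Manifold

open Bundle VectorField FiberBundle

variable {E : Type*} [NormedAddCommGroup E] [NormedSpace ℝ E]
  {M : Type*} [TopologicalSpace M] [ChartedSpace E M]

variable (E M) in
/-- Smooth real functions on `M`. -/
abbrev Fun : Type _ := C^∞⟮𝓘(ℝ, E), M; ℝ⟯

lemma minSmoothness_two_le : minSmoothness ℝ 2 ≤ ∞ := by
  rw [minSmoothness_of_isRCLikeNormedField]
  exact WithTop.coe_le_coe.mpr (le_top : (2 : ℕ∞) ≤ ⊤)

lemma minSmoothness_three_le : minSmoothness ℝ 3 ≤ ∞ := by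
  rw [minSmoothness_of_isRCLikeNormedField]
  exact WithTop.coe_le_coe.mpr (le_top : (3 : ℕ∞) ≤ ⊤)

lemma fun_mdiffAt (f : Fun E M) (x : M) : MDiffAt f x :=
  f.contMDiff.contMDiffAt.mdifferentiableAt (by simp)

variable [IsManifold 𝓘(ℝ, E) ∞ M]

variable (E M) in
/-- Smooth vector fields on `M`. -/
abbrev VF : Type _ := Cₛ^∞⟮𝓘(ℝ, E); E, (TangentSpace 𝓘(ℝ, E) : M → Type _)⟯

instance : SMul (Fun E M) (VF E M) where
  smul f X := ⟨fun x => f x • X x, f.contMDiff.smul_section X.contMDiff⟩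

lemma smul_vf_apply (f : Fun E M) (X : VF E M) (x : M) : (f • X) x = f x • X x := rfl

instance : Module (Fun E M) (VF E M) where
  one_smul X := by ext x; exact one_smul ℝ (X x)
  mul_smul f g X := by ext x; exact mul_smul (f x) (g x) (X x)
  smul_zero f := by ext x; exact smul_zero (f x)
  smul_add f X Y := by ext x; exact smul_add (f x) (X x) (Y x)
  add_smul f g X := by ext x; exact add_smul (f x) (g x) (X x)
  zero_smul X := by ext x; exact zero_smul ℝ (X x)

/-- The derivative `X f` of a smooth function `f` along a smooth vector field `X`. -/
def dirFun (X : VF E M) (f : Fun E M) : Fun E M :=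
  ⟨fun x => mvfderiv 𝓘(ℝ, E) f x (X x), by
    have h1 : ContMDiff 𝓘(ℝ, E).tangent 𝓘(ℝ, ℝ).tangent ∞ (tangentMap 𝓘(ℝ, E) 𝓘(ℝ, ℝ) f) :=
      f.contMDiff.contMDiff_tangentMap (by simp)
    have h2 := h1.comp X.contMDiff
    intro x
    exact ((Bundle.contMDiffAt_totalSpace.mp (h2 x)).2).congr_of_eventuallyEq
      (Filter.Eventually.of_forall fun y => by simp [mvfderiv, tangentMap]; rfl)⟩

variable (E M) in
/-- The action of smooth vector fields on smooth functions by derivations. -/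
def dir : VF E M →ₗ[Fun E M] Derivation ℝ (Fun E M) (Fun E M) where
  toFun X := Derivation.mk'
    { toFun := dirFun X
      map_add' := by
        intro f g; ext x
        change mvfderiv 𝓘(ℝ, E) (⇑f + ⇑g) x (X x) = _
        rw [mvfderiv_add (fun_mdiffAt f x) (fun_mdiffAt g x)]; rfl
      map_smul' := by
        intro c f; ext x
        change mvfderiv 𝓘(ℝ, E) ((fun _ : M => c) • ⇑f) x (X x) = _
        rw [mvfderiv_smul mdifferentiableAt_const (fun_mdiffAt f x), mvfderiv_const]
        simp only [add_apply, smul_apply,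
          ContinuousLinearMap.smulRight_apply, zero_apply, zero_smul, add_zero]
        rfl } (by
      intro f g; ext x
      change mvfderiv 𝓘(ℝ, E) (⇑f * ⇑g) x (X x) = _
      rw [mvfderiv_mul (fun_mdiffAt f x) (fun_mdiffAt g x)]; rfl)
  map_add' X Y := by
    ext f x
    exact map_add (mvfderiv 𝓘(ℝ, E) f x) (X x) (Y x)
  map_smul' f X := by
    ext g x
    exact map_smul (mvfderiv 𝓘(ℝ, E) g x) (f x) (X x)

variable [CompleteSpace E]

/-- The Lie bracket of smooth vector fields. -/
def bracketVF (X Y : VF E M) : VF E M :=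
  ⟨mlieBracket 𝓘(ℝ, E) X Y, by
    intro x
    have : IsManifold 𝓘(ℝ, E) (minSmoothness ℝ 2) M :=
      IsManifold.of_le (n := ∞) minSmoothness_two_le
    have : IsManifold 𝓘(ℝ, E) (((⊤ : ℕ∞) : ℕ∞ω) + 1) M := IsManifold.of_le (n := ∞) (by simp)
    exact ContMDiffAt.mlieBracket_vectorField (m := ⊤) (n := ⊤) (X.contMDiff x) (Y.contMDiff x)
      (by simp)⟩

lemma bracket_bracket_smul (X Y : VF E M) (f : Fun E M) (W : Π x : M, TangentSpace 𝓘(ℝ, E) x) (x : M)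
    (hW : ContMDiffAt 𝓘(ℝ, E) 𝓘(ℝ, E).tangent ∞
      (fun x => (⟨x, W x⟩ : TangentBundle 𝓘(ℝ, E) M)) x)
    (hW' : ∀ᶠ y in nhds x, MDifferentiableAt 𝓘(ℝ, E) 𝓘(ℝ, E).tangent
      (fun x => (⟨x, W x⟩ : TangentBundle 𝓘(ℝ, E) M)) y) :
    mlieBracket 𝓘(ℝ, E) X (mlieBracket 𝓘(ℝ, E) Y (⇑f • W)) x =
      (dir E M X (dir E M Y f) x • W x + dir E M Y f x • mlieBracket 𝓘(ℝ, E) X W x) +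
      (dir E M X f x • mlieBracket 𝓘(ℝ, E) Y W x +
        f x • mlieBracket 𝓘(ℝ, E) X (mlieBracket 𝓘(ℝ, E) Y W) x) := by
  have : IsManifold 𝓘(ℝ, E) (minSmoothness ℝ 2) M :=
    IsManifold.of_le (n := ∞) minSmoothness_two_le
  have : IsManifold 𝓘(ℝ, E) (((⊤ : ℕ∞) : ℕ∞ω) + 1) M := IsManifold.of_le (n := ∞) (by simp)
  have hYW : MDifferentiableAt 𝓘(ℝ, E) 𝓘(ℝ, E).tangent
      (fun x => (⟨x, mlieBracket 𝓘(ℝ, E) Y W x⟩ : TangentBundle 𝓘(ℝ, E) M)) x :=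
    (ContMDiffAt.mlieBracket_vectorField (m := ⊤) (n := ⊤) (Y.contMDiff x) hW
      (by simp)).mdifferentiableAt (by simp)
  have h1 : mlieBracket 𝓘(ℝ, E) Y (⇑f • W) =ᶠ[nhds x]
      (⇑(dir E M Y f) • W + ⇑f • mlieBracket 𝓘(ℝ, E) Y W :) := by
    filter_upwards [hW'] with y hy
    exact mlieBracket_smul_right (fun_mdiffAt f y) hy
  have h2 : mlieBracket 𝓘(ℝ, E) X (mlieBracket 𝓘(ℝ, E) Y (⇑f • W)) x = mlieBracket 𝓘(ℝ, E) X
      (⇑(dir E M Y f) • W + ⇑f • mlieBracket 𝓘(ℝ, E) Y W) x :=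
    Filter.EventuallyEq.mlieBracket_vectorField_eq (Filter.EventuallyEq.refl _ _) h1
  rw [h2, mlieBracket_add_right, mlieBracket_smul_right (fun_mdiffAt _ x) hW'.self_of_nhds,
    mlieBracket_smul_right (fun_mdiffAt _ x) hYW]
  · rfl
  · exact (fun_mdiffAt _ x).smul_section hW'.self_of_nhds
  · exact (fun_mdiffAt _ x).smul_section hYW

lemma dir_bracketVF (X Y : VF E M) (f : Fun E M) :
    dir E M (bracketVF X Y) f = dir E M X (dir E M Y f) - dir E M Y (dir E M X f) := by
  have : IsManifold 𝓘(ℝ, E) (minSmoothness ℝ 2) M :=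
      IsManifold.of_le (n := ∞) minSmoothness_two_le
  have : IsManifold 𝓘(ℝ, E) (minSmoothness ℝ 3) M :=
    IsManifold.of_le (n := ∞) minSmoothness_three_le
  ext x
  rcases subsingleton_or_nontrivial E with hE | hE
  · have h0 : ∀ (Z : VF E M) (g : Fun E M), dir E M Z g x = 0 := fun Z g =>
      (congrArg (mvfderiv 𝓘(ℝ, E) g x) (Subsingleton.elim (α := E) (Z x) 0)).trans (map_zero _)
    change dir E M (bracketVF X Y) f x = dir E M X (dir E M Y f) x - dir E M Y (dir E M X f) x
    rw [h0, h0, h0, sub_zero]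
  · obtain ⟨v, hv⟩ : ∃ v : TangentSpace 𝓘(ℝ, E) x, v ≠ 0 := exists_ne (0 : E)
    have hW := contMDiffAt_extend (I := 𝓘(ℝ, E)) (F := E) (k := ∞)
      (V := (TangentSpace 𝓘(ℝ, E) : M → Type _)) (x := x) v
    set W := extend E (E := (TangentSpace 𝓘(ℝ, E) : M → Type _)) (x := x) v with hWdef
    have hWx : W x = v := extend_apply_self E v
    have hW' : ∀ᶠ y in nhds x, MDifferentiableAt 𝓘(ℝ, E) 𝓘(ℝ, E).tangent
        (fun x => (⟨x, W x⟩ : TangentBundle 𝓘(ℝ, E) M)) y := by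
      obtain ⟨s, hs, h⟩ := exists_contMDiffOn_extend (I := 𝓘(ℝ, E)) (F := E) (k := ∞)
        (V := (TangentSpace 𝓘(ℝ, E) : M → Type _)) (x₀ := x) v
      filter_upwards [eventually_mem_nhds_iff.mpr hs] with y hy
      exact (h.contMDiffAt hy).mdifferentiableAt (by simp)
    have hfW : ContMDiffAt 𝓘(ℝ, E) 𝓘(ℝ, E).tangent ∞
        (fun x => (⟨x, (⇑f • W) x⟩ : TangentBundle 𝓘(ℝ, E) M)) x :=
      (f.contMDiff x).smul_section hW
    have hle : minSmoothness ℝ 2 ≤ ∞ := minSmoothness_two_le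
    have j1 := leibniz_identity_mlieBracket_apply ((X.contMDiff x).of_le hle)
      ((Y.contMDiff x).of_le hle) (hW.of_le hle)
    have j2 := leibniz_identity_mlieBracket_apply ((X.contMDiff x).of_le hle)
      ((Y.contMDiff x).of_le hle) (hfW.of_le hle)
    rw [bracket_bracket_smul X Y f W x hW hW', bracket_bracket_smul Y X f W x hW hW',
      mlieBracket_smul_right (fun_mdiffAt f x) hW'.self_of_nhds, j1] at j2
    have j3 : (dir E M (bracketVF X Y) f x - (dir E M X (dir E M Y f) x -
        dir E M Y (dir E M X f) x)) • W x = 0 := by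
      have : dir E M (bracketVF X Y) f x • W x = d% f x (mlieBracket 𝓘(ℝ, E) X Y x) • W x := rfl
      rw [sub_smul, sub_smul, this]
      rw [smul_add] at j2
      linear_combination (norm := module) -j2
    rcases smul_eq_zero.mp j3 with h | h
    · exact sub_eq_zero.mp h
    · exact absurd (hWx.symm.trans h) hv

/-- The connection on the module of smooth vector fields given by a smooth covariant derivative on
the tangent bundle. -/
def conn (cov : CovariantDerivative 𝓘(ℝ, E) E (TangentSpace 𝓘(ℝ, E) : M → Type _))
    [hcov : cov.ContMDiffCovariantDerivative ∞] : Connection (dir E M) (VF E M) where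
  toFun X Y := ⟨fun x => cov Y x (X x), by
    have h := hcov.contMDiff.contMDiff (σ := Y) (by exact Y.contMDiff.contMDiffOn)
    rw [contMDiffOn_univ] at h
    exact h.clm_bundle_apply X.contMDiff⟩
  add_left X Y Z := by ext x; exact map_add (cov Z x) (X x) (Y x)
  smul_left f X Y := by ext x; exact map_smul (cov Y x) (f x) (X x)
  add_right X Y Z := by
    ext x
    exact congrArg (fun L => L (X x)) (cov.isCovariantDerivativeOnUniv.add
      Y.mdifferentiableAt Z.mdifferentiableAt)
  leibniz X f Y := by
    ext x
    exact congrArg (fun L : TangentSpace 𝓘(ℝ, E) x →L[ℝ] TangentSpace 𝓘(ℝ, E) x => L (X x))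
      (cov.isCovariantDerivativeOnUniv.leibniz
      Y.mdifferentiableAt (fun_mdiffAt f x))

lemma bracketVF_add_left (X Y Z : VF E M) :
    bracketVF (X + Y) Z = bracketVF X Z + bracketVF Y Z := by
  ext x
  exact mlieBracket_add_left X.mdifferentiableAt Y.mdifferentiableAt

lemma bracketVF_swap (X Y : VF E M) : bracketVF X Y = -bracketVF Y X := by
  ext x
  exact mlieBracket_swap_apply

lemma bracketVF_smul_left (f : Fun E M) (X Y : VF E M) :
    bracketVF (f • X) Y = f • bracketVF X Y - dir E M Y f • X := by
  ext x
  refine (mlieBracket_smul_left (fun_mdiffAt f x) X.mdifferentiableAt).trans ?_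
  rw [add_comm, neg_smul, ← sub_eq_add_neg]
  rfl

variable (c : Connection (dir E M) (VF E M))

/-- The curvature `R(X, Y)Z = ∇_X ∇_Y Z - ∇_Y ∇_X Z - ∇_{[X, Y]} Z`, as a function. -/
def curvFun (X Y Z : VF E M) : VF E M :=
  c.toFun X (c.toFun Y Z) - c.toFun Y (c.toFun X Z) - c.toFun (bracketVF X Y) Z

lemma curvFun_swap (X Y Z : VF E M) : curvFun c X Y Z = -curvFun c Y X Z := by
  have h : c.toFun (bracketVF X Y) Z = -c.toFun (bracketVF Y X) Z := by
    have := c.smul_left (-1) (bracketVF Y X) Z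
    simpa [← bracketVF_swap] using this
  rw [curvFun, curvFun, h]
  abel

lemma curvFun_add_left (X X' Y Z : VF E M) :
    curvFun c (X + X') Y Z = curvFun c X Y Z + curvFun c X' Y Z := by
  simp only [curvFun, bracketVF_add_left, c.add_left, c.add_right]
  abel

lemma curvFun_smul_left (f : Fun E M) (X Y Z : VF E M) :
    curvFun c (f • X) Y Z = f • curvFun c X Y Z := by
  have h : c.toFun (bracketVF (f • X) Y) Z =
      f • c.toFun (bracketVF X Y) Z - dir E M Y f • c.toFun X Z := by
    rw [bracketVF_smul_left, sub_eq_add_neg, ← neg_smul, c.add_left, c.smul_left, c.smul_left,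
      neg_smul, ← sub_eq_add_neg]
  simp only [curvFun, h, c.smul_left, c.leibniz, smul_sub]
  abel

/-- The curvature tensor of the connection, as an `R`-trilinear map `X, Y, Z ↦ R(X, Y)Z`. -/
def curvature : VF E M →ₗ[Fun E M] VF E M →ₗ[Fun E M] VF E M →ₗ[Fun E M] VF E M :=
  LinearMap.mk₂ (Fun E M)
    (fun X Y =>
      { toFun := curvFun c X Y
        map_add' := by
          intro Z Z'
          simp only [curvFun, c.add_right]
          abel
        map_smul' := by
          intro f Z
          simp only [curvFun, c.add_right, c.leibniz, dir_bracketVF, sub_smul, smul_sub,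
            RingHom.id_apply]
          abel })
    (by intro X X' Y; ext1 Z; exact curvFun_add_left c X X' Y Z)
    (by intro f X Y; ext1 Z; exact curvFun_smul_left c f X Y Z)
    (by
      intro X Y Y'; ext1 Z
      change curvFun c X (Y + Y') Z = curvFun c X Y Z + curvFun c X Y' Z
      rw [curvFun_swap, curvFun_add_left, neg_add, ← curvFun_swap, ← curvFun_swap])
    (by
      intro f X Y; ext1 Z
      change curvFun c X (f • Y) Z = f • curvFun c X Y Z
      rw [curvFun_swap, curvFun_smul_left, ← smul_neg, ← curvFun_swap])

lemma curvature_self (X : VF E M) : curvature c X X = 0 := by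
  have h : bracketVF X X = 0 := by
    ext x
    exact congrFun mlieBracket_self x
  have h0 : ∀ Z, c.toFun 0 Z = 0 := fun Z => by simpa using c.smul_left 0 0 Z
  ext1 Z
  change curvFun c X X Z = 0
  rw [curvFun, h, h0, sub_self, sub_zero]

/-- The curvature of the connection as a two-form with values in formal fibrewise vector fields. -/
def curvatureTwoForm :
    Form (Fun E M) (VF E M) (Formal (Fun E M) (VF E M) (VF E M)) 2 :=
  curvatureForm (curvature c) (curvature_self c)

end Manifold

/-! ### Spaces of forms on a manifold -/

section Omega

variable (E : Type*) [NormedAddCommGroup E] [NormedSpace ℝ E]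
  (M : Type*) [TopologicalSpace M] [ChartedSpace E M] [IsManifold 𝓘(ℝ, E) ∞ M]

/-- `Ω^q(M, 𝒮M)`. -/
abbrev OmegaS (q : ℕ) : Type _ := Form (Fun E M) (VF E M) (Formal (Fun E M) (VF E M) (Fun E M)) q

/-- `q`-forms on `M` with values in formal fibrewise vector fields
`∑ vʲ_{i₁…i_p}(x) y^{i₁} ⋯ y^{i_p} ∂/∂yʲ`, given by their coefficient tensors. -/
abbrev OmegaVect (q : ℕ) : Type _ :=
  Form (Fun E M) (VF E M) (Formal (Fun E M) (VF E M) (VF E M)) q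

/-- `q`-forms on `M` with values in `C^∞(M)`-multilinear operators on `Γ(𝒮M)` with `n` arguments. -/
abbrev OmegaOp (n q : ℕ) : Type _ := Form (Fun E M) (VF E M) (Op (Fun E M) (VF E M) n) q

/-- `q`-forms on `M` with values in formal fibrewise polyvector fields of degree `n - 1`. -/
def OmegaTPoly (n q : ℕ) : Set (OmegaOp E M n q) := {Φ | ∀ X, Φ X ∈ PolyVector (Fun E M) (VF E M) n}

/-- `q`-forms on `M` with values in formal fibrewise polydifferential operators of degree
`n - 1`. -/
def OmegaDPoly (n q : ℕ) : Set (OmegaOp E M n q) := {Φ | ∀ X, Φ X ∈ PolyDiffOp (Fun E M) (VF E M) n}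

end Omega

end Fedosov

end

/-!
Everything takes place over the `C^∞(M)`-module of vector fields; the manifold only contributes that
vector fields form a Lie algebra acting on functions and, as the torsion vanishes, the formula
`[X, Y] = ∇_X Y - ∇_Y X`.

A formal series is determined by its values `a (y, …, y)` on the diagonal (`symTensor_ext`), so that
identities between series become identities between polynomials in a vector field `y`. In this way
`act` is seen to be a pre-Lie action (`act_act_sub`), whence the Jacobi identity, and `∇` a derivation
of it (`formal_act`). Since `δ` is the bracket with the tautological one-form `X ↦ X`, regarded as
constant in `y`, all three operators `D` are exterior covariant derivatives of connections `∇ + A'`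
with `A' = A - const` (`fedosovD_eq`, `fedosovDOp_eq`, `extDeriv_fedosovConnVect`). The square of the
exterior covariant derivative of a flat connection vanishes: it commutes with Lie derivatives, by
Cartan's formula and induction on the degree of the form (`extDeriv_extDeriv`). The curvature on
operators is induced by that on `𝒮M` (`curv_multilinear`), where it acts by the vector field
`C = R + ∇ A - δ A + ½ [A, A]` (`curv_gauge`, `fedosovCurv_eq_gaugeCurv`). So it remains to show
`C = 0`.

The operator `δ⁻¹` raises the degree in `y` by one, and the bracket of series that vanish at `y = 0`
does not lower it below either factor. Hence each step of the iteration improves agreement by one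
degree (`fedosovStep_congr`), which gives the limit `A`, its independence of the starting point and
the fixed point equation; `δ⁻¹ A = 0` follows from `δ⁻¹ δ⁻¹ = 0`. With the homotopy formula
`δ δ⁻¹ + δ⁻¹ δ = id` (`delta_deltaInv_add`), the fixed point equation becomes `δ⁻¹ C = 0`, and the
Bianchi identity `δ C = ∇ C + [A, C]` (`bianchi_fedosovCurv`) becomes `C = δ⁻¹ (∇ C + [A, C])`. The
right-hand side in degree `p` only involves `C` in lower degrees, so that `C = 0` by induction
(`fedosovCurv_fedosovLimit`).
-/

set_option linter.unusedSectionVars false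

open scoped Manifold ContDiff

noncomputable section

namespace Fedosov

/-! ### Evaluation of formal series on the diagonal -/

section Evaluation

variable {R V N P : Type*} [CommRing R] [Algebra ℝ R] [AddCommGroup V] [Module R V]
  [AddCommGroup N] [Module R N] [AddCommGroup P] [Module R P]

lemma inv_smul_nsmul (k : ℕ) (hk : k ≠ 0) (x : N) :
    algebraMap ℝ R ((k : ℝ)⁻¹) • k • x = x := by
  have h : (k : ℝ) ≠ 0 := Nat.cast_ne_zero.mpr hk
  rw [← Nat.cast_smul_eq_nsmul R, smul_smul, ← map_natCast (algebraMap ℝ R), ← map_mul,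
    inv_mul_cancel₀ h, map_one, one_smul]

lemma eq_zero_of_nsmul_eq_zero (R : Type*) {N : Type*} [CommRing R] [Algebra ℝ R]
    [AddCommGroup N] [Module R N] {k : ℕ} (hk : k ≠ 0) {x : N} (h : k • x = 0) : x = 0 := by
  rw [← inv_smul_nsmul (R := R) k hk x, h, smul_zero]

/-- The alternating sum of the subsets containing the range of `r` vanishes unless `r` is onto. -/
lemma sum_neg_one_pow_card_range {n : ℕ} (r : Fin n → Fin n) :
    ∑ s : Finset (Fin n), (if ∀ j, r j ∈ s then (-1 : ℤ) ^ s.card else 0) =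
      if Function.Surjective r then (-1) ^ n else 0 := by
  split_ifs with hr
  · rw [Finset.sum_eq_single Finset.univ]
    · simp
    · intro s _ hs
      rw [if_neg]
      intro h
      exact hs (Finset.eq_univ_of_forall fun i => by obtain ⟨j, rfl⟩ := hr i; exact h j)
    · simp
  · obtain ⟨i, hi⟩ := not_forall.mp hr
    have hri : ∀ j, r j ≠ i := fun j h => hi ⟨j, h⟩
    refine Finset.sum_involution (fun s _ => if i ∈ s then s.erase i else insert i s) ?_ ?_ ?_ ?_
    · intro s _
      by_cases his : i ∈ s
      · have hc : s.card = (s.erase i).card + 1 := (Finset.card_erase_add_one his).symm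
        simp only [his, if_true, Finset.mem_erase, ne_eq, hri, not_false_eq_true, true_and]
        split_ifs
        · rw [hc, pow_succ]; ring
        · rfl
      · have hc : (insert i s).card = s.card + 1 := Finset.card_insert_of_notMem his
        simp only [his, if_false, Finset.mem_insert, hri, false_or]
        split_ifs
        · rw [hc, pow_succ]; ring
        · rfl
    · intro s _ _ h
      by_cases his : i ∈ s
      · rw [if_pos his] at h
        exact Finset.notMem_erase i s (h.symm ▸ his)
      · rw [if_neg his] at h
        exact his (h ▸ Finset.mem_insert_self i s)
    · simp
    · intro s _
      by_cases his : i ∈ s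
      · simp [his]
      · simp [his]

/-- Polarization: a symmetric tensor over an algebra over `ℝ` is determined by the polynomial
`y ↦ m (y, …, y)`. -/
lemma symTensor_ext {n : ℕ} {m m' : SymTensor R V N n}
    (h : ∀ y : V, m.1 (fun _ => y) = m'.1 (fun _ => y)) : m = m' := by
  rw [← sub_eq_zero]
  set a := m - m' with ha
  have h0 : ∀ y : V, a.1 (fun _ => y) = 0 := fun y => by
    change m.1 _ - m'.1 _ = 0
    rw [h, sub_self]
  ext v
  change a.1 v = 0
  have hsum : ∀ s : Finset (Fin n),
      ∑ r : Fin n → Fin n, (if ∀ j, r j ∈ s then a.1 (fun j => v (r j)) else 0) = 0 := by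
    intro s
    have := a.1.map_sum_finset (fun _ => v) (fun _ => s)
    rw [h0] at this
    rw [← Finset.sum_filter]
    refine (Finset.sum_congr ?_ fun _ _ => rfl).trans this.symm
    ext r
    simp [Fintype.mem_piFinset]
  have hv : ∀ r : Fin n → Fin n, Function.Surjective r → a.1 (fun j => v (r j)) = a.1 v := by
    intro r hr
    exact congrArg (fun m => m v)
      (a.2 (Equiv.ofBijective r (Finite.injective_iff_bijective.mp
        (Finite.injective_iff_surjective.mpr hr))))
  -- Sum the expansions of `a (∑_{i ∈ s} v i, …)` with signs over all `s`: by inclusion-exclusion only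
  -- the permutations of `v` survive, and these all contribute the same multiple of `a v`.
  have hall : ∑ s : Finset (Fin n), (-1 : ℤ) ^ s.card •
      ∑ r : Fin n → Fin n, (if ∀ j, r j ∈ s then a.1 (fun j => v (r j)) else 0) = 0 :=
    Finset.sum_eq_zero fun s _ => by rw [hsum, smul_zero]
  simp only [Finset.smul_sum, smul_ite, smul_zero] at hall
  rw [Finset.sum_comm] at hall
  have hr : ∀ r : Fin n → Fin n,
      (∑ s : Finset (Fin n),
        if ∀ j, r j ∈ s then (-1 : ℤ) ^ s.card • a.1 (fun j => v (r j)) else 0) =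
      if Function.Surjective r then (-1 : ℤ) ^ n • a.1 v else 0 := by
    intro r
    have := congrArg (fun k : ℤ => k • a.1 (fun j => v (r j))) (sum_neg_one_pow_card_range r)
    simp only [Finset.sum_smul, ite_smul, zero_smul] at this
    rw [this]
    split_ifs with hs
    · rw [hv r hs]
    · rfl
  rw [Finset.sum_congr rfl fun r _ => hr r, ← Finset.sum_filter, Finset.sum_const] at hall
  have h1 := eq_zero_of_nsmul_eq_zero R (Finset.card_ne_zero_of_mem (a := id)
    (Finset.mem_filter.mpr ⟨Finset.mem_univ _, Function.surjective_id⟩)) hall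
  rcases neg_one_pow_eq_or ℤ n with hn | hn
  · simpa [hn] using h1
  · simpa [hn] using h1

/-- The value at `y` of the polynomial given by the component of degree `n` of a formal series. -/
def ev (y : V) (n : ℕ) : Formal R V N →ₗ[R] N where
  toFun a := (a n).1 fun _ => y
  map_add' _ _ := rfl
  map_smul' _ _ := rfl

/-- The derivative at `y` in the direction `Z` of a multilinear map regarded as a polynomial. -/
def polar {n : ℕ} (m : MultilinearMap R (fun _ : Fin n => V) N) (y Z : V) : N :=
  ∑ i, m (Function.update (fun _ => y) i Z)

/-- The derivative at `y` in the direction `Z` of the polynomial given by the component of degree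
`n` of a formal series; the result has degree `n - 1` in `y`. -/
def pol (y Z : V) (n : ℕ) : Formal R V N →ₗ[R] N where
  toFun a := polar (a n).1 y Z
  map_add' a b := by
    change ∑ i, ((a n).1 _ + (b n).1 _) = _
    rw [Finset.sum_add_distrib]; rfl
  map_smul' f a := by
    change ∑ i, (f • (a n).1 _) = _
    rw [← Finset.smul_sum]; rfl

lemma formal_ext {a b : Formal R V N} (h : ∀ (y : V) (n : ℕ), ev y n a = ev y n b) : a = b :=
  funext fun n => symTensor_ext fun y => h y n

lemma polar_sym {n : ℕ} (m : SymTensor R V N (n + 1)) (y Z : V) :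
    polar m.1 y Z = (n + 1) • m.1 (Fin.cons Z fun _ => y) := by
  have : ∀ i, m.1 (Function.update (fun _ => y) i Z) = m.1 (Fin.cons Z fun _ => y) := by
    intro i
    have h := congrArg (fun m => m (Fin.cons Z fun _ => y)) (m.2 (Equiv.swap 0 i))
    simp only [MultilinearMap.domDomCongr_apply] at h
    rw [← h]
    congr 1
    funext j
    by_cases hj : j = i
    · subst hj; simp
    · rw [Function.update_of_ne hj]
      have : Equiv.swap 0 i j ≠ 0 := by
        intro h0
        apply hj
        rw [← (Equiv.swap 0 i).apply_eq_iff_eq, h0, Equiv.swap_apply_right]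
      obtain ⟨k, hk⟩ := Fin.exists_succ_eq.mpr this
      rw [← hk, Fin.cons_succ]
  rw [polar, Finset.sum_congr rfl fun i _ => this i]
  simp

lemma pol_zero (y Z : V) (a : Formal R V N) : pol y Z 0 a = 0 := rfl

lemma ev_dirDeriv (y Z : V) (n : ℕ) (a : Formal R V N) :
    ev y n (dirDeriv Z a) = pol y Z (n + 1) a :=
  (polar_sym (a (n + 1)) y Z).symm

lemma pol_self (y : V) (n : ℕ) (a : Formal R V N) : pol y y n a = n • ev y n a := by
  change ∑ i, (a n).1 (Function.update (fun _ => y) i y) = n • (a n).1 fun _ => y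
  have : ∀ i : Fin n, Function.update (fun _ => y) i y = fun _ => y := fun i =>
    Function.update_eq_self i _
  simp only [this]
  simp

lemma symmetrize_diag {n : ℕ} (m : MultilinearMap R (fun _ : Fin n => V) N) (y : V) :
    (symmetrize m).1 (fun _ => y) = m fun _ => y := by
  change algebraMap ℝ R ((n.factorial : ℝ)⁻¹) • (∑ σ : Equiv.Perm (Fin n), m.domDomCongr σ) _ = _
  rw [sum_apply]
  simp only [MultilinearMap.domDomCongr_apply, Finset.sum_const, Finset.card_univ,
    Fintype.card_perm, Fintype.card_fin]
  exact inv_smul_nsmul _ n.factorial_ne_zero _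

/-- Symmetrization changes neither the polynomial of a multilinear map nor its derivative. -/
lemma symmetrize_polar {n : ℕ} (m : MultilinearMap R (fun _ : Fin n => V) N) (y Z : V) :
    polar (symmetrize m).1 y Z = polar m y Z := by
  change ∑ i, algebraMap ℝ R ((n.factorial : ℝ)⁻¹) •
    (∑ σ : Equiv.Perm (Fin n), m.domDomCongr σ) _ = _
  simp only [sum_apply, MultilinearMap.domDomCongr_apply]
  rw [← Finset.smul_sum, Finset.sum_comm]
  have : ∀ σ : Equiv.Perm (Fin n),
      ∑ i, m (fun j => Function.update (fun _ => y) i Z (σ j)) = polar m y Z := by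
    intro σ
    refine Fintype.sum_equiv σ.symm _ _ fun i => ?_
    congr 1
    funext j
    simp only [Function.update_apply, Equiv.eq_symm_apply]
  simp only [this, Finset.sum_const, Finset.card_univ, Fintype.card_perm, Fintype.card_fin]
  exact inv_smul_nsmul _ n.factorial_ne_zero _

lemma fuse_diag {p r n : ℕ} (h : p + r = n) (g : P →ₗ[R] MultilinearMap R (fun _ : Fin r => V) N)
    (f : MultilinearMap R (fun _ : Fin p => V) P) (y : V) :
    (fuse h g f).1 (fun _ => y) = g (f fun _ => y) fun _ => y :=
  symmetrize_diag _ y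

/-- The Leibniz rule for the composite polynomial `y ↦ g (f y) y`. -/
lemma fuse_polar {p r n : ℕ} (h : p + r = n) (g : P →ₗ[R] MultilinearMap R (fun _ : Fin r => V) N)
    (f : MultilinearMap R (fun _ : Fin p => V) P) (y Z : V) :
    polar (fuse h g f).1 y Z = g (polar f y Z) (fun _ => y) + polar (g (f fun _ => y)) y Z := by
  rw [fuse, symmetrize_polar]
  subst h
  rw [polar, ← Equiv.sum_comp finSumFinEquiv, Fintype.sum_sum_type, polar, map_sum,
    sum_apply]
  congr 1
  · refine Finset.sum_congr rfl fun i _ => ?_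
    simp only [MultilinearMap.domDomCongr_apply, MultilinearMap.uncurrySum_apply]
    change g (f _) _ = g (f _) _
    congr 2
    · congr 1
      funext j
      simp [Function.update_apply]
    · funext j
      simp [Function.update_apply, Fin.ext_iff]
      omega
  · refine Finset.sum_congr rfl fun i _ => ?_
    simp only [MultilinearMap.domDomCongr_apply, MultilinearMap.uncurrySum_apply]
    change g (f _) _ = g (f _) _
    congr 2
    · congr 1
      funext j
      simp [Function.update_apply, Fin.ext_iff]
      omega
    · funext j
      simp [Function.update_apply]

end Evaluation

/-! ### The calculus of formal vector fields -/

section Calculus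

open Finset.HasAntidiagonal (antidiagonal mem_antidiagonal)

lemma sum_antidiagonal_assoc {M : Type*} [AddCommMonoid M] (f : ℕ → ℕ → ℕ → M) (n : ℕ) :
    ∑ p ∈ antidiagonal n, ∑ q ∈ antidiagonal p.2, f p.1 q.1 q.2 =
      ∑ p ∈ antidiagonal n, ∑ q ∈ antidiagonal p.1, f q.1 q.2 p.2 := by
  rw [Finset.sum_sigma', Finset.sum_sigma']
  refine Finset.sum_nbij' (fun x => ⟨(x.1.1 + x.2.1, x.2.2), (x.1.1, x.2.1)⟩)
    (fun x => ⟨(x.2.1, x.2.2 + x.1.2), (x.2.2, x.1.2)⟩) ?_ ?_ ?_ ?_ ?_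
  · rintro ⟨⟨a, b⟩, ⟨c, d⟩⟩ h
    simp only [Finset.mem_sigma, mem_antidiagonal, and_true] at h ⊢
    grind
  · rintro ⟨⟨a, b⟩, ⟨c, d⟩⟩ h
    simp only [Finset.mem_sigma, mem_antidiagonal, and_true] at h ⊢
    grind
  · rintro ⟨⟨a, b⟩, ⟨c, d⟩⟩ h
    simp only [Finset.mem_sigma, mem_antidiagonal] at h
    simp only [h.2]
  · rintro ⟨⟨a, b⟩, ⟨c, d⟩⟩ h
    simp only [Finset.mem_sigma, mem_antidiagonal] at h
    simp only [h.2]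
  · simp

lemma sum_antidiagonal_left_comm {M : Type*} [AddCommMonoid M] (f : ℕ → ℕ → ℕ → M) (n : ℕ) :
    ∑ p ∈ antidiagonal n, ∑ q ∈ antidiagonal p.2, f p.1 q.1 q.2 =
      ∑ p ∈ antidiagonal n, ∑ q ∈ antidiagonal p.2, f q.1 p.1 q.2 := by
  rw [sum_antidiagonal_assoc, sum_antidiagonal_assoc fun a b c => f b a c]
  refine Finset.sum_congr rfl fun p _ => ?_
  exact (Finset.Nat.sum_antidiagonal_swap (f := fun q => f q.1 q.2 p.2)).symm

variable {R V N : Type*} [CommRing R] [Algebra ℝ R] [AddCommGroup V] [Module R V]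
  [AddCommGroup N] [Module R N]

lemma pol_eq_zero (y Z : V) {n : ℕ} {a : Formal R V N} (h : a n = 0) : pol y Z n a = 0 := by
  change polar (a n).1 y Z = 0
  rw [h]
  exact Finset.sum_const_zero

lemma ev_mul (y : V) (n : ℕ) (a b : Formal R V R) :
    ev y n (mul a b) = ∑ p ∈ antidiagonal n, ev y p.1 a * ev y p.2 b := by
  rw [← Finset.sum_attach]
  change (∑ i ∈ _, fuse _ _ _ : SymTensor R V R n).1 _ = _
  rw [Submodule.coe_sum, sum_apply]
  refine Finset.sum_congr rfl fun i _ => ?_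
  rw [fuse_diag]
  rfl

lemma pol_mul (y Z : V) (n : ℕ) (a b : Formal R V R) :
    pol y Z n (mul a b) =
      ∑ p ∈ antidiagonal n, (pol y Z p.1 a * ev y p.2 b + ev y p.1 a * pol y Z p.2 b) := by
  rw [← Finset.sum_attach]
  change ∑ k : Fin n, (∑ i ∈ _, fuse _ _ _ : SymTensor R V R n).1 _ = _
  simp only [Submodule.coe_sum, sum_apply]
  rw [Finset.sum_comm]
  refine Finset.sum_congr rfl fun i _ => ?_
  refine (fuse_polar _ _ _ y Z).trans ?_
  congr 1
  exact (Finset.mul_sum _ _ _).symm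

lemma ev_act (y : V) (n : ℕ) (v : Formal R V V) (a : Formal R V N) :
    ev y n (act v a) = ∑ p ∈ antidiagonal n, ev y p.2 (dirDeriv (ev y p.1 v) a) := by
  rw [← Finset.sum_attach]
  change (∑ i ∈ _, fuse _ _ _ : SymTensor R V N n).1 _ = _
  rw [Submodule.coe_sum, sum_apply]
  refine Finset.sum_congr rfl fun i _ => ?_
  rw [fuse_diag]
  rfl

lemma pol_act (y Z : V) (n : ℕ) (v : Formal R V V) (a : Formal R V N) :
    pol y Z n (act v a) = ∑ p ∈ antidiagonal n,
      (ev y p.2 (dirDeriv (pol y Z p.1 v) a) + pol y Z p.2 (dirDeriv (ev y p.1 v) a)) := by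
  rw [← Finset.sum_attach]
  change ∑ k : Fin n, (∑ i ∈ _, fuse _ _ _ : SymTensor R V N n).1 _ = _
  simp only [Submodule.coe_sum, sum_apply]
  rw [Finset.sum_comm]
  refine Finset.sum_congr rfl fun i _ => ?_
  exact fuse_polar _ _ _ y Z

lemma mul_comm (a b : Formal R V R) : mul a b = mul b a := by
  refine formal_ext fun y n => ?_
  rw [ev_mul, ev_mul, ← Finset.Nat.sum_antidiagonal_swap]
  exact Finset.sum_congr rfl fun p _ => _root_.mul_comm _ _

lemma dirDeriv_mul (Z : V) (a b : Formal R V R) :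
    dirDeriv Z (mul a b) = mul (dirDeriv Z a) b + mul a (dirDeriv Z b) := by
  refine formal_ext fun y n => ?_
  rw [ev_dirDeriv, pol_mul, Finset.sum_add_distrib, Finset.Nat.sum_antidiagonal_succ,
    Finset.Nat.sum_antidiagonal_succ', pol_zero, pol_zero, zero_mul, mul_zero, zero_add, zero_add,
    map_add, ev_mul, ev_mul]
  simp only [ev_dirDeriv]

lemma dirDeriv_comm (Z W : V) (a : Formal R V N) :
    dirDeriv Z (dirDeriv W a) = dirDeriv W (dirDeriv Z a) := by
  funext n
  ext v
  change (n + 1) • (n + 1 + 1) • (a (n + 1 + 1)).1 _ = (n + 1) • (n + 1 + 1) • (a (n + 1 + 1)).1 _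
  congr 2
  have h := congrArg (fun m => m (Fin.cons W (Fin.cons Z v)))
    ((a (n + 1 + 1)).2 (Equiv.swap 0 1))
  simp only [MultilinearMap.domDomCongr_apply] at h
  rw [← h]
  congr 1
  funext j
  refine Fin.cases ?_ (fun j => Fin.cases ?_ (fun j => ?_) j) j
  · simp
  · simp
  · rw [Equiv.swap_apply_of_ne_of_ne]
    · rfl
    · exact Fin.succ_ne_zero _
    · intro h
      exact Fin.succ_ne_zero j (Fin.succ_injective _ h)

/-- The product rule for `∂/∂y`. -/
lemma dirDeriv_act (Z : V) (v : Formal R V V) (a : Formal R V N) :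
    dirDeriv Z (act v a) = act (dirDeriv Z v) a + act v (dirDeriv Z a) := by
  refine formal_ext fun y n => ?_
  rw [ev_dirDeriv, pol_act, Finset.sum_add_distrib, Finset.Nat.sum_antidiagonal_succ,
    Finset.Nat.sum_antidiagonal_succ', pol_zero, pol_zero, map_zero, LinearMap.zero_apply, map_zero,
    zero_add, zero_add, map_add, ev_act, ev_act]
  congr 1
  · simp only [ev_dirDeriv]
  · refine Finset.sum_congr rfl fun p _ => ?_
    rw [← dirDeriv_comm, ev_dirDeriv]

lemma act_mul (v : Formal R V V) (a b : Formal R V R) :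
    act v (mul a b) = mul (act v a) b + mul a (act v b) := by
  refine formal_ext fun y n => ?_
  rw [ev_act, map_add, ev_mul, ev_mul]
  simp only [dirDeriv_mul, map_add, ev_mul, Finset.sum_add_distrib]
  congr 1
  · rw [sum_antidiagonal_assoc fun i j k => ev y j (dirDeriv (ev y i v) a) * ev y k b]
    refine Finset.sum_congr rfl fun p _ => ?_
    rw [ev_act, Finset.sum_mul]
  · rw [sum_antidiagonal_left_comm fun i j k => ev y j a * ev y k (dirDeriv (ev y i v) b)]
    refine Finset.sum_congr rfl fun p _ => ?_
    rw [ev_act, Finset.mul_sum]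

/-- The associator of the product `act` is symmetric in its first two arguments. -/
lemma act_act_sub (v w : Formal R V V) (a : Formal R V N) :
    act v (act w a) - act (act v w) a = act w (act v a) - act (act w v) a := by
  -- The associator is the second derivative of `a` in the directions `v (y)` and `w (y)`.
  have key : ∀ (v w : Formal R V V) (y : V) (n : ℕ),
      ev y n (act v (act w a) - act (act v w) a) =
      ∑ p ∈ antidiagonal n, ∑ q ∈ antidiagonal p.2,
        ev y q.2 (dirDeriv (ev y q.1 w) (dirDeriv (ev y p.1 v) a)) := by
    intro v w y n
    have h1 : ev y n (act v (act w a)) =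
        ∑ p ∈ antidiagonal n, (∑ q ∈ antidiagonal p.2,
          ev y q.2 (dirDeriv (ev y q.1 (dirDeriv (ev y p.1 v) w)) a) +
        ∑ q ∈ antidiagonal p.2, ev y q.2 (dirDeriv (ev y q.1 w) (dirDeriv (ev y p.1 v) a))) := by
      rw [ev_act]
      refine Finset.sum_congr rfl fun p _ => ?_
      rw [dirDeriv_act, map_add, ev_act, ev_act]
    have h2 : ev y n (act (act v w) a) =
        ∑ p ∈ antidiagonal n, ∑ q ∈ antidiagonal p.1,
          ev y p.2 (dirDeriv (ev y q.2 (dirDeriv (ev y q.1 v) w)) a) := by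
      rw [ev_act]
      refine Finset.sum_congr rfl fun p _ => ?_
      rw [ev_act]
      exact map_sum (ev y p.2 ∘ₗ dirDeriv.flip a) _ _
    rw [map_sub, h1, h2, Finset.sum_add_distrib, sum_antidiagonal_assoc fun i j k =>
      ev y k (dirDeriv (ev y j (dirDeriv (ev y i v) w)) a), add_sub_cancel_left]
  refine formal_ext fun y n => ?_
  rw [key, key, sum_antidiagonal_left_comm fun i j k =>
    ev y k (dirDeriv (ev y j w) (dirDeriv (ev y i v) a))]
  refine Finset.sum_congr rfl fun p _ => Finset.sum_congr rfl fun q _ => ?_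
  rw [dirDeriv_comm]

lemma lie_apply (v w : Formal R V V) : lie v w = act v w - act w v := rfl

/-- `act` represents the Lie algebra of formal vector fields. -/
lemma act_lie (v w : Formal R V V) (a : Formal R V N) :
    act (lie v w) a = act v (act w a) - act w (act v a) := by
  rw [lie_apply, map_sub, LinearMap.sub_apply]
  linear_combination (norm := module) -act_act_sub v w a

lemma lie_swap (v w : Formal R V V) : lie v w = -lie w v := (neg_sub _ _).symm

/-- The Jacobi identity. -/
lemma lie_lie (u v w : Formal R V V) : lie (lie u v) w = lie u (lie v w) - lie v (lie u w) := by
  simp only [lie_apply, map_sub, LinearMap.sub_apply]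
  linear_combination (norm := module)
    -act_act_sub u v w + act_act_sub u w v - act_act_sub v w u

variable (R) in
/-- A vector field, regarded as a formal fibrewise vector field constant in `y`. -/
def const : V →ₗ[R] Formal R V V where
  toFun Z
    | 0 => ⟨MultilinearMap.constOfIsEmpty R _ Z, fun _ => rfl⟩
    | _ + 1 => 0
  map_add' S T := by
    funext p
    match p with
    | 0 => rfl
    | _ + 1 => exact (add_zero 0).symm
  map_smul' f T := by
    funext p
    match p with
    | 0 => rfl
    | _ + 1 => exact (smul_zero f).symm

lemma ev_const_zero (y Z : V) : ev y 0 (const R Z) = Z := rfl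

lemma ev_const_succ (y Z : V) (n : ℕ) : ev y (n + 1) (const R Z) = 0 := rfl

lemma act_const (Z : V) (a : Formal R V N) : act (const R Z) a = dirDeriv Z a := by
  refine formal_ext fun y n => ?_
  rw [ev_act]
  cases n with
  | zero => simp [ev_const_zero]
  | succ n =>
    rw [Finset.Nat.sum_antidiagonal_succ]
    simp [ev_const_zero, ev_const_succ]

lemma dirDeriv_const (Z W : V) : dirDeriv Z (const R W) = 0 := by
  funext p
  ext v
  exact smul_zero _

lemma lie_const (Z : V) (w : Formal R V V) : lie (const R Z) w = dirDeriv Z w := by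
  have : act w (const R Z) = 0 := by
    refine formal_ext fun y n => ?_
    rw [ev_act]
    simp [dirDeriv_const]
  rw [lie_apply, this, sub_zero, act_const]

lemma ev_linearField_one (y : V) (T : V →ₗ[R] V) : ev y 1 (linearField T) = T y := rfl

lemma ev_linearField_zero (y : V) (T : V →ₗ[R] V) : ev y 0 (linearField T) = 0 := rfl

lemma ev_linearField_add_two (y : V) (T : V →ₗ[R] V) (n : ℕ) :
    ev y (n + 2) (linearField T) = 0 := rfl

lemma ev_act_linearField (y : V) (n : ℕ) (T : V →ₗ[R] V) (a : Formal R V N) :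
    ev y n (act (linearField T) a) = pol y (T y) n a := by
  rw [ev_act]
  match n with
  | 0 => simp [ev_linearField_zero, pol_zero]
  | 1 =>
    rw [Finset.Nat.sum_antidiagonal_succ]
    simp [ev_linearField_zero, ev_linearField_one, ev_dirDeriv]
  | n + 2 =>
    rw [Finset.Nat.sum_antidiagonal_succ, Finset.Nat.sum_antidiagonal_succ]
    simp [ev_linearField_zero, ev_linearField_one, ev_linearField_add_two, ev_dirDeriv]

lemma pol_linearField_one (y Z : V) (T : V →ₗ[R] V) : pol y Z 1 (linearField T) = T Z := by
  change ∑ i : Fin 1, T (Function.update (fun _ => y) i Z 0) = T Z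
  simp

lemma dirDeriv_linearField (Z : V) (T : V →ₗ[R] V) :
    dirDeriv Z (linearField T) = const R (T Z) := by
  refine formal_ext fun y n => ?_
  rw [ev_dirDeriv]
  cases n with
  | zero => rw [zero_add, pol_linearField_one, ev_const_zero]
  | succ n =>
    rw [ev_const_succ]
    exact pol_eq_zero y Z rfl

lemma ev_act_linearField_right (y : V) (n : ℕ) (T : V →ₗ[R] V) (w : Formal R V V) :
    ev y n (act w (linearField T)) = T (ev y n w) := by
  rw [ev_act]
  simp only [dirDeriv_linearField]
  cases n with
  | zero => simp [ev_const_zero]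
  | succ n =>
    rw [Finset.Nat.sum_antidiagonal_succ']
    simp [ev_const_zero, ev_const_succ]

variable {dir : V →ₗ[R] Derivation ℝ R R} (c : Connection dir V) (cN : Connection dir N)

/-- The chain rule `(∇_X a)(y) = ∇_X (a (y)) - ∂_{∇_X y} a (y)` at a vector field `y`. -/
lemma ev_formal (X y : V) (n : ℕ) (a : Formal R V N) :
    ev y n ((c.formal cN).toFun X a) = cN.toFun X (ev y n a) - pol y (c.toFun X y) n a := rfl

lemma dirDeriv_formal (X Z : V) (a : Formal R V N) :
    (c.formal cN).toFun X (dirDeriv Z a) =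
      dirDeriv (c.toFun X Z) a + dirDeriv Z ((c.formal cN).toFun X a) := by
  have hs : ∀ (k : ℕ) (b : N), cN.toFun X (k • b) = k • cN.toFun X b := by
    intro k b
    induction k with
    | zero => simp [cN.zero_right]
    | succ k ih => rw [succ_nsmul, cN.add_right, ih, succ_nsmul]
  funext n
  ext v
  change cN.toFun X ((n + 1) • (a (n + 1)).1 (Fin.cons Z v)) -
    ∑ i, (n + 1) • (a (n + 1)).1 (Fin.cons Z (Function.update v i (c.toFun X (v i)))) =
    (n + 1) • (a (n + 1)).1 (Fin.cons (c.toFun X Z) v) +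
    (n + 1) • (cN.toFun X ((a (n + 1)).1 (Fin.cons Z v)) -
      ∑ i, (a (n + 1)).1 (Function.update (Fin.cons Z v : Fin (n + 1) → V) i
        (c.toFun X ((Fin.cons Z v : Fin (n + 1) → V) i))))
  rw [hs, Fin.sum_univ_succ, ← Finset.smul_sum]
  simp only [Fin.cons_zero, Fin.cons_succ, Fin.update_cons_zero, ← Fin.cons_update]
  module

lemma Connection.sum_right {B : Type*} [AddCommGroup B] [Module R B] (cB : Connection dir B) (X : V)
    {ι : Type*} (s : Finset ι) (b : ι → B) :
    cB.toFun X (∑ i ∈ s, b i) = ∑ i ∈ s, cB.toFun X (b i) :=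
  map_sum (AddMonoidHom.mk' (cB.toFun X) (cB.add_right X)) b s

lemma Connection.sub_right {B : Type*} [AddCommGroup B] [Module R B] (cB : Connection dir B)
    (X : V) (b b' : B) : cB.toFun X (b - b') = cB.toFun X b - cB.toFun X b' :=
  map_sub (AddMonoidHom.mk' (cB.toFun X) (cB.add_right X)) b b'

lemma Connection.neg_right {B : Type*} [AddCommGroup B] [Module R B] (cB : Connection dir B)
    (X : V) (b : B) : cB.toFun X (-b) = -cB.toFun X b :=
  map_neg (AddMonoidHom.mk' (cB.toFun X) (cB.add_right X)) b

/-- The covariant derivative is a derivation of the action of vector fields. -/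
lemma formal_act (X : V) (v : Formal R V V) (a : Formal R V N) :
    (c.formal cN).toFun X (act v a) =
      act ((c.formal c).toFun X v) a + act v ((c.formal cN).toFun X a) := by
  refine formal_ext fun y n => ?_
  rw [ev_formal, ev_act, pol_act, cN.sum_right, map_add, ev_act, ev_act, ← Finset.sum_sub_distrib,
    ← Finset.sum_add_distrib]
  refine Finset.sum_congr rfl fun p _ => ?_
  have h := ev_formal c cN X y p.2 (dirDeriv (ev y p.1 v) a)
  rw [dirDeriv_formal, map_add] at h
  rw [ev_formal, map_sub, LinearMap.sub_apply, map_sub]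
  linear_combination (norm := module) -h

lemma formal_lie (X : V) (v w : Formal R V V) :
    (c.formal c).toFun X (lie v w) =
      lie ((c.formal c).toFun X v) w + lie v ((c.formal c).toFun X w) := by
  simp only [lie_apply, Connection.sub_right, formal_act]
  abel

lemma formal_mul (X : V) (a b : Formal R V R) :
    (c.formal (.trivial dir)).toFun X (mul a b) =
      mul ((c.formal (.trivial dir)).toFun X a) b + mul a ((c.formal (.trivial dir)).toFun X b) := by
  refine formal_ext fun y n => ?_
  rw [ev_formal, ev_mul, pol_mul, Connection.sum_right, map_add, ev_mul, ev_mul,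
    ← Finset.sum_sub_distrib, ← Finset.sum_add_distrib]
  refine Finset.sum_congr rfl fun p _ => ?_
  simp only [ev_formal]
  change dir X (_ * _) - _ = (dir X _ - _) * _ + _ * (dir X _ - _)
  rw [Derivation.leibniz]
  simp only [smul_eq_mul]
  ring

lemma formal_const (X Z : V) :
    (c.formal c).toFun X (const R Z) = const R (c.toFun X Z) := by
  refine formal_ext fun y n => ?_
  rw [ev_formal]
  cases n with
  | zero => exact sub_zero _
  | succ n =>
    have : pol y (c.toFun X y) (n + 1) (const R Z) = 0 := pol_eq_zero _ _ rfl
    rw [ev_const_succ, ev_const_succ, c.zero_right, this, sub_zero]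

lemma ev_formal_linearField (X y : V) (n : ℕ) (T : V →ₗ[R] V) :
    ev y n ((c.formal c).toFun X (linearField T)) =
      if n = 1 then c.toFun X (T y) - T (c.toFun X y) else 0 := by
  rw [ev_formal]
  match n with
  | 0 => simp [ev_linearField_zero, pol_zero, c.zero_right]
  | 1 => rw [pol_linearField_one, ev_linearField_one, if_pos rfl]
  | n + 2 =>
    have : pol y (c.toFun X y) (n + 2) (linearField T) = 0 := pol_eq_zero y _ rfl
    rw [ev_linearField_add_two, c.zero_right, this, sub_zero, if_neg (by omega)]

lemma ev_linearField (y : V) (n : ℕ) (T : V →ₗ[R] V) :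
    ev y n (linearField T) = if n = 1 then T y else 0 := by
  match n with
  | 0 => rfl
  | 1 => rfl
  | n + 2 => exact (if_neg (by omega)).symm

end Calculus

/-! ### The exterior covariant derivative of a flat connection -/

section Cartan

lemma removeNth_zero_vecCons {V : Type*} {q : ℕ} (X : V) (v : Fin q → V) :
    (0 : Fin (q + 1)).removeNth (Matrix.vecCons X v : Fin (q + 1) → V) = v := by
  funext j
  simp [Fin.removeNth]

lemma removeNth_succ_vecCons {V : Type*} {q : ℕ} (X : V) (v : Fin (q + 1) → V)
    (i : Fin (q + 1)) : i.succ.removeNth (Matrix.vecCons X v : Fin (q + 2) → V) =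
      Matrix.vecCons X (i.removeNth v) := by
  funext j
  refine Fin.cases ?_ (fun j => ?_) j
  · simp [Fin.removeNth]
  · simp [Fin.removeNth]

variable {R V B : Type*} [CommRing R] [Algebra ℝ R] [AddCommGroup V] [Module R V]
  [AddCommGroup B] [Module R B]
  {dir : V →ₗ[R] Derivation ℝ R R} (c : Connection dir V) (cB : Connection dir B)

/-- The Lie bracket `∇_X Y - ∇_Y X` of vector fields determined by a torsion-free connection. -/
def Connection.bracket (X Y : V) : V := c.toFun X Y - c.toFun Y X

/-- The curvature `∇_X ∇_Y b - ∇_Y ∇_X b - ∇_{[X, Y]} b` of a connection on `B`. -/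
def Connection.curv (X Y : V) (b : B) : B :=
  cB.toFun X (cB.toFun Y b) - cB.toFun Y (cB.toFun X b) - cB.toFun (c.bracket X Y) b

/-- The Lie derivative of forms, by Cartan's formula `L_X = i_X d + d i_X`. -/
def lieDeriv (X : V) : ∀ {q : ℕ}, Form R V B q → Form R V B q
  | 0, η => (c.extDeriv cB η).curryLeft X
  | _ + 1, η => (c.extDeriv cB η).curryLeft X + c.extDeriv cB (η.curryLeft X)

lemma extDeriv_apply {q : ℕ} (η : Form R V B q) (v : Fin (q + 1) → V) :
    c.extDeriv cB η v = ∑ i : Fin (q + 1), (-1) ^ (i : ℕ) • (c.form cB q).toFun (v i) η (i.removeNth v) :=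
  AlternatingMap.alternatizeUncurryFin_apply _ v

lemma form_apply {q : ℕ} (X : V) (η : Form R V B q) (v : Fin q → V) :
    (c.form cB q).toFun X η v =
      cB.toFun X (η v) - ∑ i, η (Function.update v i (c.toFun X (v i))) := rfl

/-- The covariant derivative of a form, with the first argument singled out. -/
lemma form_cons {q : ℕ} (X Z : V) (η : Form R V B (q + 1)) (v : Fin q → V) :
    (c.form cB (q + 1)).toFun Z η (Matrix.vecCons X v) =
      (c.form cB q).toFun Z (η.curryLeft X) v - η (Matrix.vecCons (c.toFun Z X) v) := by
  rw [form_apply, form_apply, Fin.sum_univ_succ]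
  simp only [Matrix.vecCons, Fin.cons_zero, Fin.cons_succ, Fin.update_cons_zero, ← Fin.cons_update,
    AlternatingMap.curryLeft_apply_apply]
  abel

/-- The Lie derivative in terms of brackets: the terms of Cartan's formula that contain covariant
derivatives along the arguments cancel. -/
lemma lieDeriv_apply {q : ℕ} (X : V) (η : Form R V B q) (v : Fin q → V) :
    lieDeriv c cB X η v =
      cB.toFun X (η v) - ∑ i, η (Function.update v i (c.bracket X (v i))) := by
  cases q with
  | zero =>
    rw [lieDeriv, AlternatingMap.curryLeft_apply_apply, extDeriv_apply, Fin.sum_univ_succ]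
    simp only [Fin.val_zero, pow_zero, one_smul, form_apply, Finset.univ_eq_empty,
      Finset.sum_empty, add_zero]
    congr 3
  | succ q =>
    rw [lieDeriv, AlternatingMap.add_apply, AlternatingMap.curryLeft_apply_apply, extDeriv_apply,
      extDeriv_apply, Fin.sum_univ_succ, removeNth_zero_vecCons]
    simp only [removeNth_succ_vecCons, form_cons, Matrix.cons_val_zero, Matrix.cons_val_succ, Fin.val_zero, pow_zero,
      one_smul, Fin.val_succ, pow_succ, mul_neg, mul_one, neg_smul, smul_sub, Finset.sum_neg_distrib,
      Finset.sum_sub_distrib]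
    have hins : ∀ i : Fin (q + 1),
        (-1) ^ (i : ℕ) • η (Matrix.vecCons (c.toFun (v i) X) (i.removeNth v)) =
          η (Function.update v i (c.toFun (v i) X)) := by
      intro i
      rw [← Fin.insertNth_removeNth, AlternatingMap.map_insertNth]
    simp only [hins, form_apply c cB X, Connection.bracket]
    have hsub : ∀ i : Fin (q + 1), η (Function.update v i (c.toFun X (v i) - c.toFun (v i) X)) =
        η (Function.update v i (c.toFun X (v i))) - η (Function.update v i (c.toFun (v i) X)) :=
      fun i => η.map_update_sub v i _ _
    simp only [hsub, Finset.sum_sub_distrib]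
    abel

lemma curryLeft_lieDeriv {q : ℕ} (X Y : V) (η : Form R V B (q + 1)) :
    (lieDeriv c cB X η).curryLeft Y =
      lieDeriv c cB X (η.curryLeft Y) - η.curryLeft (c.bracket X Y) := by
  ext v
  rw [AlternatingMap.curryLeft_apply_apply, lieDeriv_apply, AlternatingMap.sub_apply,
    lieDeriv_apply, Fin.sum_univ_succ]
  simp only [Matrix.vecCons, Fin.cons_zero, Fin.cons_succ, Fin.update_cons_zero, ← Fin.cons_update,
    AlternatingMap.curryLeft_apply_apply]
  abel

lemma curryLeft_extDeriv {q : ℕ} (X : V) (η : Form R V B (q + 1)) :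
    (c.extDeriv cB η).curryLeft X = lieDeriv c cB X η - c.extDeriv cB (η.curryLeft X) :=
  (add_sub_cancel_right _ _).symm

lemma form_ext_curryLeft {q : ℕ} {η θ : Form R V B (q + 1)}
    (h : ∀ X, η.curryLeft X = θ.curryLeft X) : η = θ := by
  ext v
  have := congrArg (fun ζ : Form R V B q => ζ (Matrix.vecTail v)) (h (Matrix.vecHead v))
  simpa using this

lemma extDeriv_sub {q : ℕ} (η θ : Form R V B q) :
    c.extDeriv cB (η - θ) = c.extDeriv cB η - c.extDeriv cB θ := by
  ext v
  simp only [AlternatingMap.sub_apply, extDeriv_apply, Connection.sub_right, smul_sub,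
    Finset.sum_sub_distrib]

lemma lieDeriv_sub {q : ℕ} (X : V) (η θ : Form R V B q) :
    lieDeriv c cB X (η - θ) = lieDeriv c cB X η - lieDeriv c cB X θ := by
  ext v
  simp only [AlternatingMap.sub_apply, lieDeriv_apply, Connection.sub_right,
    Finset.sum_sub_distrib]
  abel

lemma curryLeft_sub {q : ℕ} (X : V) (η θ : Form R V B (q + 1)) :
    (η - θ).curryLeft X = η.curryLeft X - θ.curryLeft X := rfl

variable (hJ : ∀ X Y Z, c.bracket X (c.bracket Y Z) =
    c.bracket (c.bracket X Y) Z + c.bracket Y (c.bracket X Z))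
  (hflat : ∀ X Y b, c.curv cB X Y b = 0)

include hJ hflat

/-- For a flat connection the Lie derivatives represent the Lie algebra of vector fields. -/
lemma lieDeriv_lieDeriv {q : ℕ} (X Y : V) (η : Form R V B q) :
    lieDeriv c cB X (lieDeriv c cB Y η) - lieDeriv c cB Y (lieDeriv c cB X η) =
      lieDeriv c cB (c.bracket X Y) η := by
  induction q with
  | zero =>
    ext v
    simp only [AlternatingMap.sub_apply, lieDeriv_apply, Finset.univ_eq_empty, Finset.sum_empty,
      sub_zero]
    exact sub_eq_zero.mp (hflat X Y (η v))
  | succ q ih =>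
    refine form_ext_curryLeft fun Z => ?_
    have hZ := ih (η.curryLeft Z)
    have hb : η.curryLeft (c.bracket X (c.bracket Y Z)) =
        η.curryLeft (c.bracket (c.bracket X Y) Z) + η.curryLeft (c.bracket Y (c.bracket X Z)) := by
      rw [hJ, map_add]
    simp only [curryLeft_sub, curryLeft_lieDeriv, lieDeriv_sub, ← hZ, hb]
    abel

/-- For a flat connection the exterior covariant derivative commutes with Lie derivatives. -/
lemma extDeriv_lieDeriv {q : ℕ} (X : V) (η : Form R V B q) :
    c.extDeriv cB (lieDeriv c cB X η) = lieDeriv c cB X (c.extDeriv cB η) := by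
  induction q with
  | zero =>
    refine form_ext_curryLeft fun Y => ?_
    rw [curryLeft_lieDeriv]
    change lieDeriv c cB Y (lieDeriv c cB X η) =
      lieDeriv c cB X (lieDeriv c cB Y η) - lieDeriv c cB (c.bracket X Y) η
    rw [← lieDeriv_lieDeriv c cB hJ hflat, sub_sub_cancel]
  | succ q ih =>
    refine form_ext_curryLeft fun Y => ?_
    simp only [curryLeft_lieDeriv, curryLeft_extDeriv, extDeriv_sub, lieDeriv_sub, ih,
      ← lieDeriv_lieDeriv c cB hJ hflat X Y]
    abel

/-- The exterior covariant derivative of a flat connection squares to zero. -/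
lemma extDeriv_extDeriv {q : ℕ} (η : Form R V B q) :
    c.extDeriv cB (c.extDeriv cB η) = 0 := by
  induction q with
  | zero =>
    refine form_ext_curryLeft fun X => ?_
    rw [curryLeft_extDeriv, ← extDeriv_lieDeriv c cB hJ hflat]
    exact sub_self _
  | succ q ih =>
    refine form_ext_curryLeft fun X => ?_
    rw [curryLeft_extDeriv, curryLeft_extDeriv, extDeriv_sub, ih,
      ← extDeriv_lieDeriv c cB hJ hflat, sub_zero, sub_self]
    rfl

end Cartan

/-! ### Curvature of induced connections -/

section Curvature

variable {R V W N : Type*} [CommRing R] [Algebra ℝ R] [AddCommGroup V] [Module R V]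
  [AddCommGroup W] [Module R W] [AddCommGroup N] [Module R N]
  {dir : V →ₗ[R] Derivation ℝ R R} (c : Connection dir V)
  (cW : Connection dir W) (cN : Connection dir N)

lemma multilinear_apply {n : ℕ} (X : V) (m : MultilinearMap R (fun _ : Fin n => W) N)
    (w : Fin n → W) : (cW.multilinear cN n).toFun X m w =
      cN.toFun X (m w) - ∑ i, m (Function.update w i (cW.toFun X (w i))) := rfl

/-- The second covariant derivative of a multilinear map; the sums of first-order terms and, up to
transposition, of the terms with two distinct arguments differentiated are symmetric in `X` and
`Y`. -/
lemma multilinear_multilinear_apply {n : ℕ} (X Y : V)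
    (m : MultilinearMap R (fun _ : Fin n => W) N) (w : Fin n → W) :
    (cW.multilinear cN n).toFun X ((cW.multilinear cN n).toFun Y m) w =
      cN.toFun X (cN.toFun Y (m w)) -
      ∑ i, (cN.toFun X (m (Function.update w i (cW.toFun Y (w i)))) +
        cN.toFun Y (m (Function.update w i (cW.toFun X (w i))))) +
      ∑ i, ∑ j, (if j = i then m (Function.update w i (cW.toFun Y (cW.toFun X (w i)))) else
        m (Function.update (Function.update w i (cW.toFun X (w i))) j (cW.toFun Y (w j)))) := by
  have h : ∀ i j, m (Function.update (Function.update w i (cW.toFun X (w i))) j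
      (cW.toFun Y (Function.update w i (cW.toFun X (w i)) j))) =
      (if j = i then m (Function.update w i (cW.toFun Y (cW.toFun X (w i)))) else
        m (Function.update (Function.update w i (cW.toFun X (w i))) j (cW.toFun Y (w j)))) := by
    intro i j
    split_ifs with hij
    · subst hij
      rw [Function.update_self, Function.update_idem]
    · rw [Function.update_of_ne hij]
  simp only [multilinear_apply, Connection.sub_right, Connection.sum_right, h,
    Finset.sum_add_distrib, Finset.sum_sub_distrib]
  abel

/-- The curvature of the connection induced on multilinear maps acts as a derivation. -/
lemma curv_multilinear {n : ℕ} (X Y : V) (m : MultilinearMap R (fun _ : Fin n => W) N)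
    (w : Fin n → W) : c.curv (cW.multilinear cN n) X Y m w =
      c.curv cN X Y (m w) - ∑ i, m (Function.update w i (c.curv cW X Y (w i))) := by
  have hij : ∀ i j, j ≠ i →
      m (Function.update (Function.update w i (cW.toFun X (w i))) j (cW.toFun Y (w j))) =
      m (Function.update (Function.update w j (cW.toFun Y (w j))) i (cW.toFun X (w i))) := by
    intro i j h
    rw [Function.update_comm h]
  have hs : (∑ i, ∑ j, (if j = i then m (Function.update w i (cW.toFun Y (cW.toFun X (w i)))) else
        m (Function.update (Function.update w i (cW.toFun X (w i))) j (cW.toFun Y (w j))))) -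
      ∑ i, ∑ j, (if j = i then m (Function.update w i (cW.toFun X (cW.toFun Y (w i)))) else
        m (Function.update (Function.update w i (cW.toFun Y (w i))) j (cW.toFun X (w j)))) =
      ∑ i, (m (Function.update w i (cW.toFun Y (cW.toFun X (w i)))) -
        m (Function.update w i (cW.toFun X (cW.toFun Y (w i))))) := by
    rw [Finset.sum_comm (f := fun i j => (if j = i then
        m (Function.update w i (cW.toFun X (cW.toFun Y (w i)))) else
        m (Function.update (Function.update w i (cW.toFun Y (w i))) j (cW.toFun X (w j))))),
      ← Finset.sum_sub_distrib]
    refine Finset.sum_congr rfl fun i _ => ?_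
    rw [← Finset.sum_sub_distrib, Finset.sum_eq_single i]
    · simp
    · intro j _ hj
      rw [if_neg hj, if_neg hj.symm, hij i j hj, sub_self]
    · simp
  rw [Connection.curv, sub_apply, sub_apply,
    multilinear_multilinear_apply, multilinear_multilinear_apply, multilinear_apply]
  simp only [Connection.curv, MultilinearMap.map_update_sub, Finset.sum_sub_distrib,
    Finset.sum_add_distrib] at hs ⊢
  linear_combination (norm := module) hs

end Curvature

/-! ### Connections changed by a one-form, their curvature and the Bianchi identity -/

section Gauge

variable {R V B N : Type*} [CommRing R] [Algebra ℝ R] [AddCommGroup V] [Module R V]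
  [AddCommGroup B] [Module R B] [AddCommGroup N] [Module R N]
  {dir : V →ₗ[R] Derivation ℝ R R}

/-- The connection `∇ + L`, for `L` a one-form with values in endomorphisms. -/
def Connection.addOneForm (cB : Connection dir B) (L : V →ₗ[R] B →ₗ[R] B) : Connection dir B where
  toFun X b := cB.toFun X b + L X b
  add_left X Y b := by rw [cB.add_left, map_add, LinearMap.add_apply]; abel
  smul_left f X b := by rw [cB.smul_left, map_smul, LinearMap.smul_apply, smul_add]
  add_right X b b' := by rw [cB.add_right, map_add]; abel
  leibniz X f b := by rw [cB.leibniz, map_smul, smul_add]; abel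

lemma addOneForm_apply (cB : Connection dir B) (L : V →ₗ[R] B →ₗ[R] B) (X : V) (b : B) :
    (cB.addOneForm L).toFun X b = cB.toFun X b + L X b := rfl

lemma wedge_apply {q : ℕ} (L : V →ₗ[R] B →ₗ[R] B) (η : Form R V B q) (v : Fin (q + 1) → V) :
    wedge L η v = ∑ i : Fin (q + 1), (-1) ^ (i : ℕ) • L (v i) (η (i.removeNth v)) :=
  AlternatingMap.alternatizeUncurryFin_apply _ v

lemma wedge_sub_left {q : ℕ} (L L' : V →ₗ[R] B →ₗ[R] B) (η : Form R V B q) :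
    wedge (L - L') η = wedge L η - wedge L' η := by
  ext v
  simp only [wedge_apply, AlternatingMap.sub_apply, LinearMap.sub_apply, smul_sub,
    Finset.sum_sub_distrib]

variable (c : Connection dir V)

lemma extDeriv_addOneForm (cB : Connection dir B) (L : V →ₗ[R] B →ₗ[R] B) {q : ℕ}
    (η : Form R V B q) : c.extDeriv (cB.addOneForm L) η = c.extDeriv cB η + wedge L η := by
  ext v
  simp only [AlternatingMap.add_apply, wedge_apply, extDeriv_apply, form_apply,
    addOneForm_apply, ← Finset.sum_add_distrib, ← smul_add]
  refine Finset.sum_congr rfl fun i _ => ?_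
  congr 1
  abel

lemma curv_addOneForm (cB : Connection dir B) (L : V →ₗ[R] B →ₗ[R] B) (X Y : V) (b : B) :
    c.curv (cB.addOneForm L) X Y b = c.curv cB X Y b +
      (cB.toFun X (L Y b) - L Y (cB.toFun X b)) - (cB.toFun Y (L X b) - L X (cB.toFun Y b)) -
      L (c.bracket X Y) b + (L X (L Y b) - L Y (L X b)) := by
  simp only [Connection.curv, addOneForm_apply, Connection.add_right, map_add]
  abel

/-- Adding a one-form `L` to the connection on arguments and values adds the bracket with `L` to the
connection on operators. -/
lemma multilinear_addOneForm (cB : Connection dir (Formal R V R))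
    (L : V →ₗ[R] Formal R V R →ₗ[R] Formal R V R) (n : ℕ) :
    (cB.addOneForm L).multilinear (cB.addOneForm L) n =
      (cB.multilinear cB n).addOneForm (opBracket ∘ₗ L) := by
  have h : ∀ X Φ, ((cB.addOneForm L).multilinear (cB.addOneForm L) n).toFun X Φ =
      ((cB.multilinear cB n).addOneForm (opBracket ∘ₗ L)).toFun X Φ := by
    intro X Φ
    ext1 a
    change cB.toFun X (Φ a) + L X (Φ a) -
      ∑ i, Φ (Function.update a i (cB.toFun X (a i) + L X (a i))) =
      (cB.toFun X (Φ a) - ∑ i, Φ (Function.update a i (cB.toFun X (a i)))) +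
      (L X (Φ a) - (∑ i, insertAt i (L X) Φ) a)
    simp only [MultilinearMap.map_update_add, Finset.sum_add_distrib, sum_apply, insertAt_apply]
    abel
  generalize (cB.addOneForm L).multilinear (cB.addOneForm L) n = c₁ at h
  generalize (cB.multilinear cB n).addOneForm (opBracket ∘ₗ L) = c₂ at h
  obtain ⟨f₁, _, _, _, _⟩ := c₁
  obtain ⟨f₂, _, _, _, _⟩ := c₂
  obtain rfl : f₁ = f₂ := funext fun X => funext fun Φ => h X Φ
  rfl

/-- The connection `∇ - δ + A` on sections of `𝒮M`. As `δ` acts by the tautological one-form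
`X ↦ X` with values in constant vector fields, this is `∇` changed by the one-form `A - const`. -/
def fedosovConn (A : Form R V (Formal R V V) 1) : Connection dir (Formal R V R) :=
  (c.formal (.trivial dir)).addOneForm (act ∘ₗ (oneForm A - const R))

lemma fedosovD_eq {q : ℕ} (A : Form R V (Formal R V V) 1) (a : Form R V (Formal R V R) q) :
    fedosovD c A a = c.extDeriv (fedosovConn c A) a := by
  have h : (act ∘ₗ (oneForm A - const R) : V →ₗ[R] Formal R V R →ₗ[R] Formal R V R) =
      act ∘ₗ oneForm A - dirDeriv := by
    refine LinearMap.ext fun X => LinearMap.ext fun b => ?_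
    change act (oneForm A X - const R X) b = act (oneForm A X) b - dirDeriv X b
    rw [map_sub, LinearMap.sub_apply, act_const]
  rw [fedosovConn, extDeriv_addOneForm, h, wedge_sub_left, fedosovD]
  change c.extDeriv _ a - wedge dirDeriv a + wedge _ a = _
  abel

lemma fedosovDOp_eq {n q : ℕ} (A : Form R V (Formal R V V) 1) (Φ : Form R V (Op R V n) q) :
    fedosovDOp c A Φ =
      c.extDeriv ((fedosovConn c A).multilinear (fedosovConn c A) n) Φ := by
  have h : (opBracket ∘ₗ act ∘ₗ (oneForm A - const R) : V →ₗ[R] Op R V n →ₗ[R] Op R V n) =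
      opBracket ∘ₗ act ∘ₗ oneForm A - opBracket ∘ₗ dirDeriv := by
    refine LinearMap.ext fun X => ?_
    have : act (oneForm A X - const R X) =
        (act (oneForm A X) - dirDeriv X : Formal R V R →ₗ[R] Formal R V R) := by
      refine LinearMap.ext fun b => ?_
      rw [map_sub, LinearMap.sub_apply, LinearMap.sub_apply, act_const]
    change opBracket (act (oneForm A X - const R X)) =
      opBracket (act (oneForm A X)) - opBracket (dirDeriv X)
    rw [this, map_sub]
  rw [fedosovConn, multilinear_addOneForm, extDeriv_addOneForm, h, wedge_sub_left, fedosovDOp]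
  change c.extDeriv _ Φ - wedge (opBracket ∘ₗ dirDeriv) Φ + wedge _ Φ = _
  abel

/-- The connection `∇ - δ + [A, · ]` on formal fibrewise vector fields. -/
def fedosovConnVect (A : Form R V (Formal R V V) 1) : Connection dir (Formal R V V) :=
  (c.formal c).addOneForm (lie ∘ₗ (oneForm A - const R))

lemma extDeriv_fedosovConnVect {q : ℕ} (A : Form R V (Formal R V V) 1)
    (w : Form R V (Formal R V V) q) :
    c.extDeriv (fedosovConnVect c A) w = nablaVect c w - delta w + lieForm A w := by
  have h : (lie ∘ₗ (oneForm A - const R) : V →ₗ[R] Formal R V V →ₗ[R] Formal R V V) =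
      lie ∘ₗ oneForm A - dirDeriv := by
    refine LinearMap.ext fun X => LinearMap.ext fun b => ?_
    change lie (oneForm A X - const R X) b = lie (oneForm A X) b - dirDeriv X b
    rw [map_sub, LinearMap.sub_apply, lie_const]
  rw [fedosovConnVect, extDeriv_addOneForm, h, wedge_sub_left, delta, lieForm, nablaVect]
  abel

lemma bracket_swap (X Y : V) : c.bracket X Y = -c.bracket Y X := (neg_sub _ _).symm

lemma bracket_neg_left (X Y : V) : c.bracket (-X) Y = -c.bracket X Y := by
  have h : c.toFun (-X) Y = -c.toFun X Y := by simpa using c.smul_left (-1) X Y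
  rw [Connection.bracket, Connection.bracket, c.neg_right, h]
  abel

lemma bracket_cyclic (hJ : ∀ X Y Z, c.bracket X (c.bracket Y Z) =
      c.bracket (c.bracket X Y) Z + c.bracket Y (c.bracket X Z)) (X Y Z : V) :
    c.bracket (c.bracket X Y) Z + c.bracket (c.bracket Y Z) X + c.bracket (c.bracket Z X) Y = 0 := by
  have h := hJ X Y Z
  rw [bracket_swap c X (c.bracket Y Z), bracket_swap c Y (c.bracket X Z), bracket_swap c X Z,
    bracket_neg_left] at h
  linear_combination (norm := abel) -h

/-- The second Bianchi identity for a connection on an arbitrary module. -/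
lemma bianchi_curv (hJ : ∀ X Y Z, c.bracket X (c.bracket Y Z) =
      c.bracket (c.bracket X Y) Z + c.bracket Y (c.bracket X Z)) (cB : Connection dir B)
    (X Y Z : V) (b : B) :
    (cB.toFun X (c.curv cB Y Z b) - c.curv cB Y Z (cB.toFun X b) - c.curv cB (c.bracket X Y) Z b) +
    (cB.toFun Y (c.curv cB Z X b) - c.curv cB Z X (cB.toFun Y b) - c.curv cB (c.bracket Y Z) X b) +
    (cB.toFun Z (c.curv cB X Y b) - c.curv cB X Y (cB.toFun Z b) -
      c.curv cB (c.bracket Z X) Y b) = 0 := by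
  have h := congrArg (fun W => cB.toFun W b) (bracket_cyclic c hJ X Y Z)
  have h0 : cB.toFun 0 b = 0 := by simpa using cB.smul_left 0 0 b
  simp only [cB.add_left, h0] at h
  simp only [Connection.curv, cB.sub_right]
  linear_combination (norm := abel) h

variable (K : V →ₗ[R] V →ₗ[R] V →ₗ[R] V)

/-- The curvature `R + ∇_X (A Y) - ∇_Y (A X) - A [X, Y] + [A X, A Y]` of the connection `∇ + A`,
with values in formal fibrewise vector fields. -/
def gaugeCurv (A : V →ₗ[R] Formal R V V) (X Y : V) : Formal R V V :=
  linearField (-K X Y) + (c.formal c).toFun X (A Y) - (c.formal c).toFun Y (A X) -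
    A (c.bracket X Y) + lie (A X) (A Y)

variable {K} (hK : ∀ X Y Z, K X Y Z = c.curv c X Y Z)

include hK

lemma ev_curv_formal (cN : Connection dir N) (X Y y : V) (n : ℕ) (a : Formal R V N) :
    ev y n (c.curv (c.formal cN) X Y a) =
      c.curv cN X Y (ev y n a) + ev y n (act (linearField (-K X Y)) a) := by
  have h : ev y n (c.curv (c.formal cN) X Y a) =
      c.curv (c.multilinear cN n) X Y (a n).1 (fun _ => y) := rfl
  have hp : pol y (-(K X Y y)) n a = -pol y (K X Y y) n a := by
    change ∑ i : Fin n, (a n).1 (Function.update (fun _ => y) i (-K X Y y)) =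
      -∑ i : Fin n, (a n).1 (Function.update (fun _ => y) i (K X Y y))
    rw [← Finset.sum_neg_distrib]
    exact Finset.sum_congr rfl fun i _ => (a n).1.map_update_neg _ i _
  rw [h, curv_multilinear, ev_act_linearField, LinearMap.neg_apply, hp, hK, ← sub_eq_add_neg]
  rfl

/-- The curvature on formal series acts by the vector field `y ↦ -K(X, Y) y`. -/
lemma curv_formal (cN : Connection dir N) (hN : ∀ X Y b, c.curv cN X Y b = 0) (X Y : V)
    (a : Formal R V N) :
    c.curv (c.formal cN) X Y a = act (linearField (-K X Y)) a := by
  refine formal_ext fun y n => ?_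
  rw [ev_curv_formal c hK, hN, zero_add]

lemma curv_formal_vect (X Y : V) (w : Formal R V V) :
    c.curv (c.formal c) X Y w = lie (linearField (-K X Y)) w := by
  refine formal_ext fun y n => ?_
  rw [ev_curv_formal c hK, lie_apply, map_sub, ev_act_linearField_right, LinearMap.neg_apply, hK]
  abel

/-- The curvature of `∇ + A` on sections of `𝒮M` acts by the vector field `gaugeCurv`. -/
lemma curv_gauge (hdir : ∀ X Y f, c.curv (.trivial dir) X Y f = 0) (A : V →ₗ[R] Formal R V V)
    (X Y : V) (a : Formal R V R) :
    c.curv ((c.formal (.trivial dir)).addOneForm (act ∘ₗ A)) X Y a =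
      act (gaugeCurv c K A X Y) a := by
  rw [curv_addOneForm, curv_formal c hK _ hdir]
  simp only [LinearMap.comp_apply, formal_act, gaugeCurv, map_add, map_sub, LinearMap.add_apply,
    LinearMap.sub_apply, act_lie]
  abel

/-- The second Bianchi identity for the curvature of the connection on vector fields. -/
lemma bianchi_linearField (hJ : ∀ X Y Z, c.bracket X (c.bracket Y Z) =
      c.bracket (c.bracket X Y) Z + c.bracket Y (c.bracket X Z)) (X Y Z : V) :
    ((c.formal c).toFun X (linearField (-K Y Z)) - linearField (-K (c.bracket X Y) Z)) +
    ((c.formal c).toFun Y (linearField (-K Z X)) - linearField (-K (c.bracket Y Z) X)) +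
    ((c.formal c).toFun Z (linearField (-K X Y)) - linearField (-K (c.bracket Z X) Y)) = 0 := by
  refine formal_ext fun y n => ?_
  rw [map_zero, map_add, map_add, map_sub, map_sub, map_sub]
  simp only [ev_formal_linearField, ev_linearField]
  split_ifs
  · have h := bianchi_curv c hJ c X Y Z y
    simp only [LinearMap.neg_apply, hK, c.neg_right]
    linear_combination (norm := abel) -h
  · simp

/-- The Bianchi identity for the curvature of the connection `∇ + A`. -/
lemma bianchi_gauge (hJ : ∀ X Y Z, c.bracket X (c.bracket Y Z) =
      c.bracket (c.bracket X Y) Z + c.bracket Y (c.bracket X Z))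
    (A : V →ₗ[R] Formal R V V) (X Y Z : V) :
    let D := (c.formal c).addOneForm (lie ∘ₗ A)
    (D.toFun X (gaugeCurv c K A Y Z) - gaugeCurv c K A (c.bracket X Y) Z) +
    (D.toFun Y (gaugeCurv c K A Z X) - gaugeCurv c K A (c.bracket Y Z) X) +
    (D.toFun Z (gaugeCurv c K A X Y) - gaugeCurv c K A (c.bracket Z X) Y) = 0 := by
  intro D
  have h1 := bianchi_linearField c hK hJ X Y Z
  have h2 : ∀ X Y Z, (c.formal c).toFun X ((c.formal c).toFun Y (A Z)) =
      (c.formal c).toFun Y ((c.formal c).toFun X (A Z)) +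
      (c.formal c).toFun (c.bracket X Y) (A Z) + lie (linearField (-K X Y)) (A Z) := by
    intro X Y Z
    rw [← curv_formal_vect c hK, Connection.curv]
    abel
  have h3 := congrArg A (bracket_cyclic c hJ X Y Z)
  rw [map_add, map_add, map_zero] at h3
  have h4 := lie_lie (A X) (A Y) (A Z)
  have hD : ∀ X w, D.toFun X w = (c.formal c).toFun X w + lie (A X) w := fun _ _ => rfl
  simp only [hD, gaugeCurv, Connection.add_right, Connection.sub_right, formal_lie, map_add,
    map_sub]
  rw [h2 X Y Z, h2 Y Z X, h2 Z X Y,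
    lie_swap (linearField (-K X Y)) (A Z), lie_swap (linearField (-K Y Z)) (A X),
    lie_swap (linearField (-K Z X)) (A Y),
    lie_swap ((c.formal c).toFun X (A Y)) (A Z), lie_swap ((c.formal c).toFun Y (A Z)) (A X),
    lie_swap ((c.formal c).toFun Z (A X)) (A Y),
    lie_swap (A (c.bracket X Y)) (A Z), lie_swap (A (c.bracket Y Z)) (A X),
    lie_swap (A (c.bracket Z X)) (A Y)]
  rw [lie_swap (lie (A X) (A Y)), lie_swap (A X) (A Z), map_neg] at h4
  linear_combination (norm := abel) h1 + h3 - h4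

end Gauge

/-! ### The homotopy operator `δ⁻¹` -/

section Homotopy

variable {R V N : Type*} [CommRing R] [Algebra ℝ R] [AddCommGroup V] [Module R V]
  [AddCommGroup N] [Module R N]

lemma ev_deltaInv_zero {q : ℕ} (y : V) (η : Form R V (Formal R V N) (q + 1)) (X : Fin q → V) :
    ev y 0 (deltaInv η X) = 0 := rfl

lemma ev_deltaInv_succ {q : ℕ} (y : V) (p : ℕ) (η : Form R V (Formal R V N) (q + 1))
    (X : Fin q → V) : ev y (p + 1) (deltaInv η X) =
      algebraMap ℝ R (((p + q + 1 : ℕ) : ℝ)⁻¹) • ev y p (η (Matrix.vecCons y X)) := by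
  change algebraMap ℝ R (((p + q + 1 : ℕ) : ℝ)⁻¹) •
    (symmetrize _ : SymTensor R V N (p + 1)).1 (fun _ => y) = _
  rw [symmetrize_diag]
  rfl

lemma pol_deltaInv_succ {q : ℕ} (y Z : V) (p : ℕ) (η : Form R V (Formal R V N) (q + 1))
    (X : Fin q → V) : pol y Z (p + 1) (deltaInv η X) =
      algebraMap ℝ R (((p + q + 1 : ℕ) : ℝ)⁻¹) •
        (ev y p (η (Matrix.vecCons Z X)) + pol y Z p (η (Matrix.vecCons y X))) := by
  have h : ∀ m : MultilinearMap R (fun _ : Fin (p + 1) => V) N, ∀ r : R,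
      polar (r • m) y Z = r • polar m y Z := fun m r => (Finset.smul_sum).symm
  refine (h _ _).trans (congrArg (HSMul.hSMul _) ((symmetrize_polar _ y Z).trans ?_))
  rw [polar, Fin.sum_univ_succ]
  congr 1
  refine Finset.sum_congr rfl fun i _ => ?_
  change (η (Matrix.vecCons (Function.update (fun _ : Fin (p + 1) => y) i.succ Z 0) X) p).1
    (fun j => Function.update (fun _ : Fin (p + 1) => y) i.succ Z j.succ) =
    (η (Matrix.vecCons y X) p).1 (Function.update (fun _ => y) i Z)
  rw [Function.update_of_ne (Fin.succ_ne_zero i).symm]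
  congr 1
  funext j
  simp [Function.update_apply]

lemma ev_delta {q : ℕ} (y : V) (n : ℕ) (η : Form R V (Formal R V N) q) (X : Fin (q + 1) → V) :
    ev y n (delta η X) =
      ∑ i : Fin (q + 1), (-1) ^ (i : ℕ) • pol y (X i) (n + 1) (η (i.removeNth X)) := by
  rw [delta, wedge_apply, map_sum]
  refine Finset.sum_congr rfl fun i _ => ?_
  rw [map_zsmul, ev_dirDeriv]

lemma deltaInv_add {q : ℕ} (η θ : Form R V (Formal R V N) (q + 1)) :
    deltaInv (η + θ) = deltaInv η + deltaInv θ := by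
  ext1 X
  refine formal_ext fun y n => ?_
  rw [AlternatingMap.add_apply, map_add]
  cases n with
  | zero => simp only [ev_deltaInv_zero, add_zero]
  | succ n => simp only [ev_deltaInv_succ, AlternatingMap.add_apply, map_add, smul_add]

lemma deltaInv_sub {q : ℕ} (η θ : Form R V (Formal R V N) (q + 1)) :
    deltaInv (η - θ) = deltaInv η - deltaInv θ := by
  rw [eq_sub_iff_add_eq, ← deltaInv_add, sub_add_cancel]

lemma deltaInv_deltaInv {q : ℕ} (η : Form R V (Formal R V N) (q + 2)) :
    deltaInv (deltaInv η) = 0 := by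
  ext1 X
  refine formal_ext fun y n => ?_
  rw [AlternatingMap.zero_apply, map_zero]
  match n with
  | 0 => rfl
  | 1 => rw [ev_deltaInv_succ, ev_deltaInv_zero, smul_zero]
  | n + 2 =>
    rw [ev_deltaInv_succ, ev_deltaInv_succ,
      η.map_eq_zero_of_eq (Matrix.vecCons y (Matrix.vecCons y X)) (i := 0) (j := 1) rfl (by simp),
      map_zero, smul_zero, smul_zero]

/-- The homotopy `δ δ⁻¹ + δ⁻¹ δ = id` on forms of positive degree. -/
lemma delta_deltaInv_add {q : ℕ} (η : Form R V (Formal R V N) (q + 1)) :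
    delta (deltaInv η) + deltaInv (delta η) = η := by
  ext1 X
  refine formal_ext fun y n => ?_
  have hins : ∀ i : Fin (q + 1),
      (-1) ^ (i : ℕ) • η (Matrix.vecCons (X i) (i.removeNth X)) = η X := by
    intro i
    rw [← AlternatingMap.map_insertNth, Fin.insertNth_self_removeNth]
  have h1 : ev y n (delta (deltaInv η) X) = algebraMap ℝ R (((n + q + 1 : ℕ) : ℝ)⁻¹) •
      ((q + 1) • ev y n (η X) + ∑ i : Fin (q + 1), (-1) ^ (i : ℕ) •
        pol y (X i) n (η (Matrix.vecCons y (i.removeNth X)))) := by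
    have hc : ∑ i : Fin (q + 1), (-1) ^ (i : ℕ) •
        ev y n (η (Matrix.vecCons (X i) (i.removeNth X))) = (q + 1) • ev y n (η X) := by
      simp only [← map_zsmul, hins, Finset.sum_const, Finset.card_univ, Fintype.card_fin]
    rw [ev_delta, ← hc, ← Finset.sum_add_distrib, Finset.smul_sum]
    refine Finset.sum_congr rfl fun i _ => ?_
    rw [pol_deltaInv_succ, ← smul_add, smul_comm]
  rw [AlternatingMap.add_apply, map_add, h1]
  cases n with
  | zero =>
    simp only [ev_deltaInv_zero, pol_zero, smul_zero, Finset.sum_const_zero, add_zero]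
    rw [zero_add]
    exact inv_smul_nsmul _ q.succ_ne_zero _
  | succ n =>
    rw [ev_deltaInv_succ, ev_delta, Fin.sum_univ_succ (n := q + 1), removeNth_zero_vecCons]
    simp only [removeNth_succ_vecCons, Matrix.cons_val_zero, Matrix.cons_val_succ, Fin.val_zero,
      pow_zero, one_smul, Fin.val_succ, pow_succ, mul_neg, mul_one, neg_smul,
      Finset.sum_neg_distrib, pol_self]
    have hq : n + 1 + q + 1 = n + (q + 1) + 1 := by omega
    rw [hq, ← smul_add, add_add_add_comm, add_neg_cancel, add_zero, ← add_smul]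
    refine Eq.trans ?_ (inv_smul_nsmul (R := R) (n + (q + 1) + 1) (Nat.succ_ne_zero _) _)
    congr 2
    omega

end Homotopy

/-! ### Dependence on low degrees in `y` -/

section Degrees

open Finset.HasAntidiagonal (antidiagonal mem_antidiagonal)

variable {R V N : Type*} [CommRing R] [Algebra ℝ R] [AddCommGroup V] [Module R V]
  [AddCommGroup N] [Module R N]

lemma ev_congr {y : V} {n : ℕ} {a b : Formal R V N} (h : a n = b n) : ev y n a = ev y n b :=
  congrArg (fun m : SymTensor R V N n => m.1 fun _ => y) h

lemma pol_congr {y Z : V} {n : ℕ} {a b : Formal R V N} (h : a n = b n) :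
    pol y Z n a = pol y Z n b :=
  congrArg (fun m : SymTensor R V N n => polar m.1 y Z) h

lemma zsmul_congr {n : ℕ} {a b : Formal R V N} (z : ℤ) (h : a n = b n) :
    (z • a) n = (z • b) n := by
  rw [Pi.smul_apply, Pi.smul_apply, h]

/-- If the vector fields vanish at `y = 0`, then the action in degree `n` only depends on degrees
up to `n`, although the derivative lowers the degree. -/
lemma act_congr {n : ℕ} {v v' : Formal R V V} {a a' : Formal R V N} (h0 : v 0 = 0)
    (hv : ∀ k ≤ n, v k = v' k) (ha : ∀ k ≤ n, a k = a' k) : act v a n = act v' a' n := by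
  refine symTensor_ext fun y => ?_
  change ev y n (act v a) = ev y n (act v' a')
  rw [ev_act, ev_act]
  refine Finset.sum_congr rfl fun p hp => ?_
  rw [mem_antidiagonal] at hp
  have hvp : ev y p.1 v' = ev y p.1 v := ev_congr (hv p.1 (by omega)).symm
  rw [hvp]
  rcases Nat.eq_zero_or_pos p.1 with h | h
  · have : ev y p.1 v = 0 := by
      rw [h]
      exact ev_congr (b := 0) h0
    rw [this, map_zero, LinearMap.zero_apply, LinearMap.zero_apply, map_zero]
  · rw [ev_dirDeriv, ev_dirDeriv]
    exact pol_congr (ha _ (by omega))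

lemma lie_congr {n : ℕ} {v v' w w' : Formal R V V} (hv0 : v 0 = 0) (hw0 : w 0 = 0)
    (hv : ∀ k ≤ n, v k = v' k) (hw : ∀ k ≤ n, w k = w' k) : lie v w n = lie v' w' n :=
  congrArg₂ (· - ·) (act_congr hv0 hv hw) (act_congr hw0 hw hv)

lemma wedge_lie_congr {n q : ℕ} {A A' : Form R V (Formal R V V) 1}
    {w w' : Form R V (Formal R V V) q} (hA0 : ∀ X, A X 0 = 0) (hw0 : ∀ X, w X 0 = 0)
    (hA : ∀ X, ∀ k ≤ n, A X k = A' X k) (hw : ∀ X, ∀ k ≤ n, w X k = w' X k)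
    (X : Fin (q + 1) → V) : lieForm A w X n = lieForm A' w' X n := by
  rw [lieForm, lieForm, wedge_apply, wedge_apply, Finset.sum_apply, Finset.sum_apply]
  refine Finset.sum_congr rfl fun i _ => ?_
  exact zsmul_congr _ (lie_congr (hA0 _) (hw0 _) (hA _) (hw _))

variable {dir : V →ₗ[R] Derivation ℝ R R} (c : Connection dir V)

lemma nablaVect_congr {n q : ℕ} {w w' : Form R V (Formal R V V) q}
    (hw : ∀ X, w X n = w' X n) (X : Fin (q + 1) → V) :
    nablaVect c w X n = nablaVect c w' X n := by
  rw [nablaVect, nablaVect, extDeriv_apply, extDeriv_apply, Finset.sum_apply, Finset.sum_apply]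
  refine Finset.sum_congr rfl fun i _ => zsmul_congr _ ?_
  rw [form_apply, form_apply, Pi.sub_apply, Pi.sub_apply]
  congr 1
  · exact Subtype.ext (congrArg (fun m : SymTensor R V V n =>
      (c.multilinear c n).toFun (X i) m.1) (hw _))
  · rw [Finset.sum_apply, Finset.sum_apply]
    exact Finset.sum_congr rfl fun j _ => hw _

lemma deltaInv_congr {n q : ℕ} {η η' : Form R V (Formal R V N) (q + 1)}
    (h : ∀ X, η X n = η' X n) (X : Fin q → V) : deltaInv η X (n + 1) = deltaInv η' X (n + 1) := by
  refine symTensor_ext fun y => ?_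
  change ev y (n + 1) (deltaInv η X) = ev y (n + 1) (deltaInv η' X)
  rw [ev_deltaInv_succ, ev_deltaInv_succ, ev_congr (h _)]

lemma fedosovStep_zero (Rc : Form R V (Formal R V V) 2) (A : Form R V (Formal R V V) 1)
    (X : Fin 1 → V) : fedosovStep c Rc A X 0 = 0 := add_zero _

/-- The iteration raises the degree up to which two forms agree. -/
lemma fedosovStep_congr (Rc : Form R V (Formal R V V) 2) {A A' : Form R V (Formal R V V) 1} {n : ℕ}
    (h0 : ∀ X, A X 0 = 0) (h : ∀ X, ∀ k ≤ n, A X k = A' X k) (X : Fin 1 → V) (k : ℕ)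
    (hk : k ≤ n + 1) : fedosovStep c Rc A X k = fedosovStep c Rc A' X k := by
  cases k with
  | zero => rw [fedosovStep_zero, fedosovStep_zero]
  | succ k =>
    rw [fedosovStep, fedosovStep, AlternatingMap.add_apply, AlternatingMap.add_apply, Pi.add_apply,
      Pi.add_apply]
    congr 1
    refine deltaInv_congr (fun Y => ?_) X
    have hk' : ∀ X, ∀ j ≤ k, A X j = A' X j := fun X j hj => h X j (by omega)
    change nablaVect c A Y k + algebraMap ℝ R (1 / 2) • lieForm A A Y k =
      nablaVect c A' Y k + algebraMap ℝ R (1 / 2) • lieForm A' A' Y k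
    rw [nablaVect_congr c (fun Z => h Z k (by omega)) Y, wedge_lie_congr h0 h0 hk' hk' Y]

/-- The iterates of `0` under the map `fedosovStep`. -/
def fedosovIter (Rc : Form R V (Formal R V V) 2) (n : ℕ) : Form R V (Formal R V V) 1 :=
  (fedosovStep c Rc)^[n] 0

lemma fedosovIter_succ (Rc : Form R V (Formal R V V) 2) (n : ℕ) :
    fedosovIter c Rc (n + 1) = fedosovStep c Rc (fedosovIter c Rc n) :=
  Function.iterate_succ_apply' _ _ _

lemma fedosovIter_zero_degree (Rc : Form R V (Formal R V V) 2) (n : ℕ) (X : Fin 1 → V) :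
    fedosovIter c Rc n X 0 = 0 := by
  cases n with
  | zero => rfl
  | succ n => rw [fedosovIter_succ, fedosovStep_zero]

lemma fedosovIter_congr (Rc : Form R V (Formal R V V) 2) (n : ℕ) (X : Fin 1 → V) :
    ∀ k ≤ n, fedosovIter c Rc n X k = fedosovIter c Rc (n + 1) X k := by
  induction n generalizing X with
  | zero =>
    intro k hk
    obtain rfl : k = 0 := by omega
    rw [fedosovIter_zero_degree, fedosovIter_zero_degree]
  | succ n ih =>
    intro k hk
    rw [fedosovIter_succ, fedosovIter_succ c Rc (n + 1)]
    exact fedosovStep_congr c Rc (fedosovIter_zero_degree c Rc n) ih X k hk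

/-- The limit of the iteration, whose component of degree `p` in `y` is that of the `p`-th iterate
of `0`. -/
def fedosovLimit (Rc : Form R V (Formal R V V) 2) : Form R V (Formal R V V) 1 where
  toFun X p := fedosovIter c Rc p X p
  map_update_add' X i Y Z := funext fun p =>
    congrFun ((fedosovIter c Rc p).map_update_add' X i Y Z) p
  map_update_smul' X i f Y := funext fun p =>
    congrFun ((fedosovIter c Rc p).map_update_smul' X i f Y) p
  map_eq_zero_of_eq' X i j h hij := funext fun p =>
    congrFun ((fedosovIter c Rc p).map_eq_zero_of_eq' X i j h hij) p

lemma fedosovLimit_apply (Rc : Form R V (Formal R V V) 2) (X : Fin 1 → V) (n : ℕ) :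
    ∀ k ≤ n, fedosovLimit c Rc X k = fedosovIter c Rc n X k := by
  intro k hk
  induction n, hk using Nat.le_induction with
  | base => rfl
  | succ n hn ih => rw [ih, fedosovIter_congr c Rc n X k hn]

lemma fedosovLimit_zero_degree (Rc : Form R V (Formal R V V) 2) (X : Fin 1 → V) :
    fedosovLimit c Rc X 0 = 0 := rfl

lemma fedosovStep_fedosovLimit (Rc : Form R V (Formal R V V) 2) :
    fedosovStep c Rc (fedosovLimit c Rc) = fedosovLimit c Rc := by
  ext1 X
  funext p
  rw [fedosovStep_congr c Rc (fedosovLimit_zero_degree c Rc)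
    (fun X => fedosovLimit_apply c Rc X p) X p (by omega), ← fedosovIter_succ,
    fedosovLimit_apply c Rc X (p + 1) p (by omega)]

lemma iterate_fedosovStep (Rc : Form R V (Formal R V V) 2) (A₀ : Form R V (Formal R V V) 1)
    (n : ℕ) (X : Fin 1 → V) :
    ∀ k ≤ n, (fedosovStep c Rc)^[n + 1] A₀ X k = fedosovLimit c Rc X k := by
  have h0 : ∀ n X, (fedosovStep c Rc)^[n + 1] A₀ X 0 = 0 := by
    intro n X
    rw [Function.iterate_succ_apply', fedosovStep_zero]
  induction n generalizing X with
  | zero =>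
    intro k hk
    obtain rfl : k = 0 := by omega
    rw [h0, fedosovLimit_zero_degree]
  | succ n ih =>
    intro k hk
    rw [Function.iterate_succ_apply', ← fedosovStep_fedosovLimit c Rc]
    exact fedosovStep_congr c Rc (h0 n) ih X k hk

end Degrees

/-! ### Flatness of the Fedosov connection -/

section Flatness

variable {R V B : Type*} [CommRing R] [Algebra ℝ R] [AddCommGroup V] [Module R V]
  [AddCommGroup B] [Module R B]
  {dir : V →ₗ[R] Derivation ℝ R R} (c : Connection dir V)

lemma oneForm_apply (A : Form R V B 1) (Z : V) : oneForm A Z = A fun _ => Z := rfl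

lemma oneForm_apply_fin (A : Form R V B 1) (v : Fin 1 → V) : oneForm A (v 0) = A v := by
  rw [oneForm_apply]
  congr 1
  funext i
  rw [Subsingleton.elim i 0]

lemma oneForm_vec (A : Form R V B 1) (Z : V) : A ![Z] = oneForm A Z :=
  (oneForm_apply_fin A ![Z]).symm

lemma lie_sub_const (v w : Formal R V V) (X Y : V) :
    lie (v - const R X) (w - const R Y) = lie v w + dirDeriv Y v - dirDeriv X w := by
  rw [map_sub, map_sub, LinearMap.sub_apply, LinearMap.sub_apply, lie_const, lie_const,
    lie_swap v (const R Y), lie_const, dirDeriv_const]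
  abel

/-- The exterior covariant derivative of a two-form. -/
lemma extDeriv_two (cB : Connection dir B) (η : Form R V B 2) (X Y Z : V) :
    c.extDeriv cB η ![X, Y, Z] =
      (cB.toFun X (η ![Y, Z]) - η ![c.bracket X Y, Z]) +
      (cB.toFun Y (η ![Z, X]) - η ![c.bracket Y Z, X]) +
      (cB.toFun Z (η ![X, Y]) - η ![c.bracket Z X, Y]) := by
  have hswap : ∀ U W : V, η ![U, W] = -η ![W, U] := by
    intro U W
    have h := η.map_swap ![W, U] (i := 0) (j := 1) (by simp)
    rw [← h]
    congr 1
    funext i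
    fin_cases i <;> rfl
  have hneg : ∀ U W : V, η ![-U, W] = -η ![U, W] :=
    fun U W => congrArg (fun ζ : Form R V B 1 => ζ ![W]) (map_neg η.curryLeft U)
  have h1 : c.extDeriv cB η ![X, Y, Z] = ((c.extDeriv cB η).curryLeft X) ![Y, Z] := rfl
  have h2 : c.extDeriv cB (η.curryLeft X) ![Y, Z] =
    (c.extDeriv cB (η.curryLeft X)).curryLeft Y ![Z] := rfl
  have h3 : c.extDeriv cB ((η.curryLeft X).curryLeft Y) ![Z] =
    lieDeriv c cB Z ((η.curryLeft X).curryLeft Y) ![] := rfl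
  rw [h1, curryLeft_extDeriv, AlternatingMap.sub_apply, h2, curryLeft_extDeriv,
    AlternatingMap.sub_apply, h3, lieDeriv_apply, lieDeriv_apply, lieDeriv_apply]
  simp only [Fin.sum_univ_succ, AlternatingMap.curryLeft_apply_apply,
    Matrix.cons_val_zero, Fin.succ_zero_eq_one, Matrix.cons_val_one, Finset.univ_eq_empty,
    Finset.sum_empty]
  have e1 : Function.update ![Y, Z] 0 (c.bracket X Y) = ![c.bracket X Y, Z] := by
    funext i; fin_cases i <;> rfl
  have e2 : Function.update ![Y, Z] 1 (c.bracket X Z) = ![Y, c.bracket X Z] := by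
    funext i; fin_cases i <;> rfl
  have e3 : Function.update ![Z] 0 (c.bracket Y Z) = ![c.bracket Y Z] := by
    funext i; fin_cases i; rfl
  rw [e1, e2, e3]
  change cB.toFun X (η ![Y, Z]) - (η ![c.bracket X Y, Z] + (η ![Y, c.bracket X Z] + 0)) -
    (cB.toFun Y (η ![X, Z]) - (η ![X, c.bracket Y Z] + 0) - (cB.toFun Z (η ![X, Y]) - 0)) = _
  rw [hswap Y (c.bracket X Z), bracket_swap c X Z, hneg, hswap X Z, hswap X (c.bracket Y Z),
    cB.neg_right]
  abel

variable (K : V →ₗ[R] V →ₗ[R] V →ₗ[R] V) (hK0 : ∀ X, K X X = 0)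

/-- The curvature `R + ∇ A - δ A + ½ [A, A]` of the connection `∇ - δ + A`, as a two-form. -/
def fedosovCurv (A : Form R V (Formal R V V) 1) : Form R V (Formal R V V) 2 :=
  curvatureForm K hK0 + (nablaVect c A + algebraMap ℝ R (1 / 2) • lieForm A A) - delta A

lemma wedge_two {L : V →ₗ[R] B →ₗ[R] B} (η : Form R V B 1) (X Y : V) :
    wedge L η ![X, Y] = L X (oneForm η Y) - L Y (oneForm η X) := by
  rw [wedge_apply, Fin.sum_univ_two, ← oneForm_apply_fin, ← oneForm_apply_fin]
  simp [Fin.removeNth, sub_eq_add_neg]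

lemma fedosovCurv_eq_gaugeCurv (A : Form R V (Formal R V V) 1) (X Y : V) :
    fedosovCurv c K hK0 A ![X, Y] = gaugeCurv c K (oneForm A - const R) X Y := by
  have hn : nablaVect c A ![X, Y] = (c.formal c).toFun X (oneForm A Y) -
      (c.formal c).toFun Y (oneForm A X) - oneForm A (c.bracket X Y) := by
    have h1 : nablaVect c A ![X, Y] = ((nablaVect c A).curryLeft X) ![Y] := rfl
    have h2 : c.extDeriv (c.formal c) (A.curryLeft X) ![Y] =
      lieDeriv c (c.formal c) Y (A.curryLeft X) ![] := rfl
    have e : Function.update ![Y] 0 (c.bracket X Y) = ![c.bracket X Y] := by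
      funext i; fin_cases i; rfl
    rw [h1, nablaVect, curryLeft_extDeriv, AlternatingMap.sub_apply, h2, lieDeriv_apply,
      lieDeriv_apply]
    simp only [Fin.sum_univ_succ, Matrix.cons_val_zero, e,
      AlternatingMap.curryLeft_apply_apply, Finset.univ_eq_empty, Finset.sum_empty, sub_zero,
      add_zero, oneForm_vec]
    have ho : ∀ Z, (A : V [⋀^Fin (0 + 1)]→ₗ[R] Formal R V V) ![Z] = oneForm A Z := oneForm_vec A
    rw [ho, ho]
    abel
  have hl : (algebraMap ℝ R (1 / 2) • lieForm A A) ![X, Y] = lie (oneForm A X) (oneForm A Y) := by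
    rw [AlternatingMap.smul_apply, lieForm, wedge_two, LinearMap.comp_apply, LinearMap.comp_apply,
      lie_swap (oneForm A Y), sub_neg_eq_add, ← two_nsmul]
    have h := inv_smul_nsmul (R := R) 2 two_ne_zero (lie (oneForm A X) (oneForm A Y))
    rw [one_div]
    exact_mod_cast h
  rw [fedosovCurv, AlternatingMap.sub_apply, AlternatingMap.add_apply, AlternatingMap.add_apply,
    hn, hl, delta, wedge_two, gaugeCurv]
  have hR : curvatureForm K hK0 ![X, Y] = linearField (-K X Y) := rfl
  have hb : const R (c.bracket X Y) = const R (c.toFun X Y) - const R (c.toFun Y X) :=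
    map_sub _ _ _
  have hA : ∀ Z, (oneForm A - const R : V →ₗ[R] Formal R V V) Z = oneForm A Z - const R Z :=
    fun _ => rfl
  rw [hR, hA, hA, hA, lie_sub_const, Connection.sub_right, Connection.sub_right, formal_const,
    formal_const, hb]
  abel

variable {K} (hK : ∀ X Y Z, K X Y Z = c.curv c X Y Z)
  (hJ : ∀ X Y Z, c.bracket X (c.bracket Y Z) =
    c.bracket (c.bracket X Y) Z + c.bracket Y (c.bracket X Z))

include hK hJ in
/-- The Bianchi identity `∇C - δC + [A, C] = 0` for the curvature `C` of `∇ - δ + A`. -/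
lemma bianchi_fedosovCurv (A : Form R V (Formal R V V) 1) :
    nablaVect c (fedosovCurv c K hK0 A) - delta (fedosovCurv c K hK0 A) +
      lieForm A (fedosovCurv c K hK0 A) = 0 := by
  rw [← extDeriv_fedosovConnVect]
  ext1 v
  have hv : v = ![v 0, v 1, v 2] := by
    funext i; fin_cases i <;> rfl
  rw [hv, extDeriv_two]
  simp only [fedosovCurv_eq_gaugeCurv]
  exact bianchi_gauge c hK hJ _ _ _ _

lemma deltaInv_fedosovLimit (Rc : Form R V (Formal R V V) 2) :
    deltaInv (fedosovLimit c Rc) = 0 := by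
  rw [← fedosovStep_fedosovLimit, fedosovStep, ← deltaInv_add, deltaInv_deltaInv]

/-- By the homotopy formula `δ⁻¹ δ A = A` because `δ⁻¹ A = 0`, and so the fixed point equation says
that `δ⁻¹` kills the curvature. -/
lemma deltaInv_fedosovCurv :
    deltaInv (fedosovCurv c K hK0 (fedosovLimit c (curvatureForm K hK0))) = 0 := by
  have h := delta_deltaInv_add (fedosovLimit c (curvatureForm K hK0))
  have h0 : delta (0 : Form R V (Formal R V V) 0) = 0 := by
    ext1 X
    refine formal_ext fun y n => ?_
    rw [ev_delta]
    simp
  rw [deltaInv_fedosovLimit, h0] at h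
  replace h := (zero_add _).symm.trans h
  rw [fedosovCurv, deltaInv_sub, deltaInv_add]
  refine (congrArg (HSub.hSub _) h).trans (sub_eq_zero.mpr ?_)
  exact fedosovStep_fedosovLimit c (curvatureForm K hK0)

include hK hJ in
/-- The curvature of the Fedosov connection vanishes: by the Bianchi identity and the homotopy
formula, its lowest non-zero component in `y` would be determined by lower ones. -/
lemma fedosovCurv_fedosovLimit :
    fedosovCurv c K hK0 (fedosovLimit c (curvatureForm K hK0)) = 0 := by
  set A := fedosovLimit c (curvatureForm K hK0) with hA
  set C := fedosovCurv c K hK0 A with hC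
  have hb : delta C = nablaVect c C + lieForm A C := by
    have := bianchi_fedosovCurv c hK0 hK hJ A
    rw [← hC] at this
    linear_combination (norm := abel) -this
  have hh : C = deltaInv (nablaVect c C + lieForm A C) := by
    have h := delta_deltaInv_add C
    have h0 : delta (0 : Form R V (Formal R V V) 1) = 0 := by
      ext1 X
      refine formal_ext fun y n => ?_
      rw [ev_delta]
      simp
    rw [hC, deltaInv_fedosovCurv, h0, zero_add, ← hC, hb] at h
    exact h.symm
  have hz : nablaVect c (0 : Form R V (Formal R V V) 2) + lieForm A 0 = 0 := by
    have h1 : nablaVect c (0 : Form R V (Formal R V V) 2) = 0 := by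
      have := extDeriv_sub c (c.formal c) (0 : Form R V (Formal R V V) 2) 0
      rwa [sub_self, sub_self] at this
    have h2 : lieForm A (0 : Form R V (Formal R V V) 2) = 0 := by
      ext1 X
      rw [lieForm, wedge_apply]
      simp
    rw [h1, h2, add_zero]
  have h0 : ∀ X, C X 0 = 0 := by
    intro X
    rw [hh]
    rfl
  have key : ∀ n, ∀ X, ∀ k ≤ n, C X k = (0 : Form R V (Formal R V V) 2) X k := by
    intro n
    induction n with
    | zero =>
      intro X k hk
      obtain rfl : k = 0 := by omega
      exact h0 X
    | succ n ih =>
      intro X k hk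
      rcases Nat.lt_or_ge n k with h | h
      · obtain rfl : k = n + 1 := by omega
        have hz' : (0 : Form R V (Formal R V V) 2) X (n + 1) =
            deltaInv (nablaVect c (0 : Form R V (Formal R V V) 2) + lieForm A 0) X (n + 1) := by
          rw [hz]
          have := deltaInv_sub (0 : Form R V (Formal R V V) 3) 0
          rw [sub_self, sub_self] at this
          rw [this]
        rw [hz', hh]
        refine deltaInv_congr (fun Y => ?_) X
        rw [AlternatingMap.add_apply, AlternatingMap.add_apply, Pi.add_apply, Pi.add_apply,
          nablaVect_congr c (fun Z => ih Z n le_rfl) Y,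
          wedge_lie_congr (fedosovLimit_zero_degree c _) h0 (fun _ _ _ => rfl) ih Y]
      · exact ih X k h
  ext1 X
  funext k
  exact key k X k le_rfl

lemma fedosovLimit_one_degree (X : Fin 1 → V) :
    fedosovLimit c (curvatureForm K hK0) X 1 = 0 := by
  set A := fedosovLimit c (curvatureForm K hK0) with hA
  have hs : fedosovStep c (curvatureForm K hK0) A = A := fedosovStep_fedosovLimit c _
  rw [← hs]
  refine symTensor_ext fun y => ?_
  change ev y (0 + 1) (fedosovStep c (curvatureForm K hK0) A X) = 0
  have h0 : ∀ X, A X 0 = 0 := fedosovLimit_zero_degree c _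
  have hR : ∀ Y, curvatureForm K hK0 Y 0 = 0 := fun _ => rfl
  have hn : ∀ Y, nablaVect c A Y 0 = 0 := by
    intro Y
    rw [nablaVect_congr c (w' := 0) (fun Z => h0 Z) Y]
    have := extDeriv_sub c (c.formal c) (0 : Form R V (Formal R V V) 1) 0
    rw [sub_self, sub_self] at this
    rw [nablaVect, this]
    rfl
  have hl : ∀ Y, lieForm A A Y 0 = 0 := by
    intro Y
    rw [wedge_lie_congr (A' := A) (w' := 0) h0 h0 (fun _ _ _ => rfl)
      (fun Z k hk => by obtain rfl : k = 0 := by omega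
                        exact h0 Z) Y, lieForm, wedge_apply]
    simp
  have ev0 : ∀ a : Formal R V V, a 0 = 0 → ev y 0 a = 0 := fun a h => ev_congr (b := 0) h
  rw [fedosovStep, AlternatingMap.add_apply, map_add, ev_deltaInv_succ, ev_deltaInv_succ,
    AlternatingMap.add_apply, map_add, AlternatingMap.smul_apply, map_smul,
    ev0 _ (hR _), ev0 _ (hn _), ev0 _ (hl _)]
  simp

include hK hJ in
/-- The connection `∇ - δ + A` on sections of `𝒮M` is flat. -/
lemma curv_fedosovConn (hdir : ∀ X Y f, c.curv (.trivial dir) X Y f = 0) (X Y : V)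
    (a : Formal R V R) :
    c.curv (fedosovConn c (fedosovLimit c (curvatureForm K hK0))) X Y a = 0 := by
  rw [fedosovConn, curv_gauge c hK hdir, ← fedosovCurv_eq_gaugeCurv c K hK0,
    fedosovCurv_fedosovLimit c hK0 hK hJ]
  simp

include hK hJ in
lemma fedosovD_fedosovD (hdir : ∀ X Y f, c.curv (.trivial dir) X Y f = 0) {q : ℕ}
    (a : Form R V (Formal R V R) q) :
    fedosovD c (fedosovLimit c (curvatureForm K hK0))
      (fedosovD c (fedosovLimit c (curvatureForm K hK0)) a) = 0 := by
  rw [fedosovD_eq, fedosovD_eq]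
  exact extDeriv_extDeriv c _ hJ (curv_fedosovConn c hK0 hK hJ hdir) a

include hK hJ in
/-- The connection on operators is flat because that on arguments and values is. -/
lemma fedosovDOp_fedosovDOp (hdir : ∀ X Y f, c.curv (.trivial dir) X Y f = 0) {n q : ℕ}
    (Φ : Form R V (Op R V n) q) :
    fedosovDOp c (fedosovLimit c (curvatureForm K hK0))
      (fedosovDOp c (fedosovLimit c (curvatureForm K hK0)) Φ) = 0 := by
  rw [fedosovDOp_eq, fedosovDOp_eq]
  refine extDeriv_extDeriv c _ hJ (fun X Y Ψ => ?_) Φ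
  ext1 a
  rw [curv_multilinear]
  simp only [curv_fedosovConn c hK0 hK hJ hdir, zero_apply, zero_sub, neg_eq_zero]
  exact Finset.sum_eq_zero fun i _ => Ψ.map_update_zero a i

end Flatness

/-! ### Polyvector fields and polydifferential operators -/

section Membership

variable {R V B : Type*} [CommRing R] [Algebra ℝ R] [AddCommGroup V] [Module R V]
  [AddCommGroup B] [Module R B]
  {dir : V →ₗ[R] Derivation ℝ R R} (c : Connection dir V)

lemma extDeriv_mem (cB : Connection dir B) (S : AddSubgroup B)
    (hS : ∀ X, ∀ b ∈ S, cB.toFun X b ∈ S) {q : ℕ} (η : Form R V B q) (hη : ∀ v, η v ∈ S)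
    (v : Fin (q + 1) → V) : c.extDeriv cB η v ∈ S := by
  rw [extDeriv_apply]
  refine S.sum_mem fun i _ => S.zsmul_mem ?_ _
  rw [form_apply]
  exact S.sub_mem (hS _ _ (hη _)) (S.sum_mem fun j _ => hη _)

variable (R V) in
/-- Polyvector fields form a group under addition. -/
def polyVectorSubgroup (n : ℕ) : AddSubgroup (Op R V n) where
  carrier := PolyVector R V n
  zero_mem' := ⟨fun _ _ _ _ _ => rfl, fun _ _ _ _ => by simp⟩
  add_mem' := by
    rintro Φ Ψ ⟨h1, h2⟩ ⟨h3, h4⟩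
    refine ⟨fun a i j hij h => ?_, fun a i b e => ?_⟩
    · rw [add_apply, h1 a i j hij h, h3 a i j hij h, add_zero]
    · rw [add_apply, add_apply, add_apply, h2, h4, map_add, map_add]
      abel
  neg_mem' := by
    rintro Φ ⟨h1, h2⟩
    refine ⟨fun a i j hij h => ?_, fun a i b e => ?_⟩
    · rw [neg_apply, h1 a i j hij h, neg_zero]
    · rw [neg_apply, neg_apply, neg_apply, h2, map_neg, map_neg]
      abel

lemma mulCommutator_apply {n : ℕ} (i : Fin n) (e : Formal R V R) (Φ : Op R V n)
    (a : Fin n → Formal R V R) :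
    mulCommutator i e Φ a = Φ (Function.update a i (mul e (a i))) - mul e (Φ a) := by
  rw [mulCommutator, sub_apply, insertAt_apply]
  rfl

lemma mulCommutator_add {n : ℕ} (i : Fin n) (e : Formal R V R) (Φ Ψ : Op R V n) :
    mulCommutator i e (Φ + Ψ) = mulCommutator i e Φ + mulCommutator i e Ψ := by
  ext1 a
  rw [add_apply, mulCommutator_apply, mulCommutator_apply, mulCommutator_apply, add_apply,
    add_apply, map_add]
  abel

lemma mulCommutator_neg {n : ℕ} (i : Fin n) (e : Formal R V R) (Φ : Op R V n) :
    mulCommutator i e (-Φ) = -mulCommutator i e Φ := by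
  ext1 a
  rw [neg_apply, mulCommutator_apply, mulCommutator_apply, neg_apply, neg_apply, map_neg]
  abel

lemma mulCommutator_zero {n : ℕ} (i : Fin n) (e : Formal R V R) :
    mulCommutator i e (0 : Op R V n) = 0 := by
  ext1 a
  rw [mulCommutator_apply]
  simp

lemma OrderLT.add {n m : ℕ} {i : Fin n} {Φ Ψ : Op R V n} (hΦ : OrderLT i m Φ)
    (hΨ : OrderLT i m Ψ) : OrderLT i m (Φ + Ψ) := by
  induction m generalizing Φ Ψ with
  | zero =>
    change Φ + Ψ = 0
    rw [show Φ = 0 from hΦ, show Ψ = 0 from hΨ, add_zero]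
  | succ m ih =>
    intro e
    rw [mulCommutator_add]
    exact ih (hΦ e) (hΨ e)

lemma OrderLT.neg {n m : ℕ} {i : Fin n} {Φ : Op R V n} (hΦ : OrderLT i m Φ) :
    OrderLT i m (-Φ) := by
  induction m generalizing Φ with
  | zero =>
    change -Φ = 0
    rw [show Φ = 0 from hΦ, neg_zero]
  | succ m ih =>
    intro e
    rw [mulCommutator_neg]
    exact ih (hΦ e)

lemma OrderLT.succ {n m : ℕ} {i : Fin n} {Φ : Op R V n} (hΦ : OrderLT i m Φ) :
    OrderLT i (m + 1) Φ := by
  induction m generalizing Φ with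
  | zero =>
    intro e
    change mulCommutator i e Φ = 0
    rw [show Φ = 0 from hΦ, mulCommutator_zero]
  | succ m ih => exact fun e => ih (hΦ e)

lemma OrderLT.mono {n m m' : ℕ} (h : m ≤ m') {i : Fin n} {Φ : Op R V n} (hΦ : OrderLT i m Φ) :
    OrderLT i m' Φ := by
  induction m', h using Nat.le_induction with
  | base => exact hΦ
  | succ k _ ih => exact ih.succ

variable (R V) in
/-- Polydifferential operators form a group under addition. -/
def polyDiffOpSubgroup (n : ℕ) : AddSubgroup (Op R V n) where
  carrier := PolyDiffOp R V n
  zero_mem' := ⟨0, fun _ => rfl⟩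
  add_mem' := by
    rintro Φ Ψ ⟨m, hm⟩ ⟨m', hm'⟩
    exact ⟨max m m', fun i => ((hm i).mono (le_max_left _ _)).add
      ((hm' i).mono (le_max_right _ _))⟩
  neg_mem' := by
    rintro Φ ⟨m, hm⟩
    exact ⟨m, fun i => (hm i).neg⟩

/-- The covariant derivative of an operator, with the argument `i` singled out. -/
lemma multilinear_update {n : ℕ} (D : Connection dir (Formal R V R)) (X : V) (Φ : Op R V n)
    (a : Fin n → Formal R V R) (i : Fin n) (z : Formal R V R) :
    (D.multilinear D n).toFun X Φ (Function.update a i z) =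
      D.toFun X (Φ (Function.update a i z)) - Φ (Function.update a i (D.toFun X z)) -
      ∑ k ∈ Finset.univ.erase i,
        Φ (Function.update (Function.update a k (D.toFun X (a k))) i z) := by
  rw [multilinear_apply, ← Finset.add_sum_erase _ _ (Finset.mem_univ i), Function.update_self,
    Function.update_idem, sub_sub]
  congr 2
  refine Finset.sum_congr rfl fun k hk => ?_
  rw [Function.update_of_ne (Finset.ne_of_mem_erase hk),
    Function.update_comm (Finset.ne_of_mem_erase hk)]

variable {D : Connection dir (Formal R V R)}
  (hD : ∀ X b e, D.toFun X (mul b e) = mul (D.toFun X b) e + mul b (D.toFun X e))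

include hD in
/-- A connection that is a derivation of the product of `𝒮M` preserves polyvector fields. -/
lemma multilinear_mem_polyVector {n : ℕ} (X : V) (Φ : Op R V n) (hΦ : Φ ∈ PolyVector R V n) :
    (D.multilinear D n).toFun X Φ ∈ PolyVector R V n := by
  obtain ⟨halt, hder⟩ := hΦ
  refine ⟨fun a i j hij h => ?_, fun a i b e => ?_⟩
  · let Ψ : Formal R V R [⋀^Fin n]→ₗ[R] Formal R V R :=
      { Φ with map_eq_zero_of_eq' := fun v k l hv hkl => halt v k l hkl hv }
    have hs : Function.update a j (D.toFun X (a i)) =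
        Function.update a i (D.toFun X (a i)) ∘ Equiv.swap i j := by
      funext k
      by_cases hk : k = j
      · subst hk; simp
      · by_cases hk' : k = i
        · subst hk'; simp [hk, hij.symm, h]
        · simp [hk, hk', Equiv.swap_apply_of_ne_of_ne hk' hk]
    have hsum : Φ (Function.update a i (D.toFun X (a i))) +
        Φ (Function.update a j (D.toFun X (a j))) = 0 := by
      rw [← h, hs]
      change Ψ _ + Ψ _ = 0
      rw [Ψ.map_swap _ hij, add_neg_cancel]
    rw [multilinear_apply, halt a i j hij h, D.zero_right, Finset.sum_eq_add i j hij, hsum,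
      sub_zero]
    · intro k _ hk
      exact halt _ i j hij (by simp [hk.1.symm, hk.2.symm, h])
    · simp
    · simp
  · simp only [multilinear_update, hder, hD, D.add_right, MultilinearMap.map_update_add,
      Finset.sum_add_distrib, map_sub, map_sum]
    rw [mul_comm (D.toFun X e)]
    rw [mul_comm (D.toFun X b) (Φ (Function.update a i e)), mul_comm (Φ (Function.update a i e))]
    abel

include hD in
/-- A connection that is a derivation of the product satisfies the Leibniz rule for commutators with
multiplications; hence it preserves the order of differential operators. -/
lemma mulCommutator_multilinear {n : ℕ} (X : V) (Φ : Op R V n) (i : Fin n) (e : Formal R V R) :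
    mulCommutator i e ((D.multilinear D n).toFun X Φ) =
      (D.multilinear D n).toFun X (mulCommutator i e Φ) - mulCommutator i (D.toFun X e) Φ := by
  ext1 a
  have h := multilinear_update D X Φ a i (a i)
  have h' := multilinear_update D X (mulCommutator i e Φ) a i (a i)
  rw [Function.update_eq_self] at h h'
  have hk : ∀ k ∈ Finset.univ.erase i,
      mulCommutator i e Φ (Function.update (Function.update a k (D.toFun X (a k))) i (a i)) =
      Φ (Function.update (Function.update a k (D.toFun X (a k))) i (mul e (a i))) -
        mul e (Φ (Function.update (Function.update a k (D.toFun X (a k))) i (a i))) := by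
    intro k _
    rw [mulCommutator_apply, Function.update_self, Function.update_idem]
  rw [sub_apply, h', mulCommutator_apply, mulCommutator_apply, mulCommutator_apply,
    mulCommutator_apply, multilinear_update, h, Finset.sum_congr rfl hk, Function.update_self,
    Function.update_idem, hD, MultilinearMap.map_update_add, D.sub_right, hD,
    Finset.sum_sub_distrib, map_sub, map_sub, map_sum]
  abel

include hD in
lemma multilinear_orderLT {n m : ℕ} (X : V) (Φ : Op R V n) (i : Fin n) (hΦ : OrderLT i m Φ) :
    OrderLT i m ((D.multilinear D n).toFun X Φ) := by
  induction m generalizing Φ with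
  | zero =>
    change (D.multilinear D n).toFun X Φ = 0
    rw [show Φ = 0 from hΦ, Connection.zero_right]
  | succ m ih =>
    intro e
    rw [mulCommutator_multilinear hD, sub_eq_add_neg]
    exact (ih _ (hΦ e)).add (hΦ _).neg

lemma fedosovConn_mul (A : Form R V (Formal R V V) 1) (X : V) (b e : Formal R V R) :
    (fedosovConn c A).toFun X (mul b e) =
      mul ((fedosovConn c A).toFun X b) e + mul b ((fedosovConn c A).toFun X e) := by
  rw [fedosovConn, addOneForm_apply, addOneForm_apply, addOneForm_apply, formal_mul,
    LinearMap.comp_apply, act_mul, map_add, map_add, LinearMap.add_apply]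
  abel

lemma fedosovDOp_mem_polyVector {n q : ℕ} (A : Form R V (Formal R V V) 1)
    (Φ : Form R V (Op R V n) q) (hΦ : ∀ v, Φ v ∈ PolyVector R V n) (v : Fin (q + 1) → V) :
    fedosovDOp c A Φ v ∈ PolyVector R V n := by
  rw [fedosovDOp_eq]
  exact extDeriv_mem c _ (polyVectorSubgroup R V n)
    (multilinear_mem_polyVector (fedosovConn_mul c A)) Φ hΦ v

lemma fedosovDOp_mem_polyDiffOp {n q : ℕ} (A : Form R V (Formal R V V) 1)
    (Φ : Form R V (Op R V n) q) (hΦ : ∀ v, Φ v ∈ PolyDiffOp R V n) (v : Fin (q + 1) → V) :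
    fedosovDOp c A Φ v ∈ PolyDiffOp R V n := by
  rw [fedosovDOp_eq]
  exact extDeriv_mem c _ (polyDiffOpSubgroup R V n)
    (fun X Ψ ⟨m, hm⟩ => ⟨m, fun i => multilinear_orderLT (fedosovConn_mul c A) X Ψ i (hm i)⟩) Φ hΦ v

end Membership

/-! ### Torsion-free connections on a manifold -/

section ManifoldInput

open Bundle VectorField

variable {E : Type*} [NormedAddCommGroup E] [NormedSpace ℝ E] [FiniteDimensional ℝ E]
  [CompleteSpace E]
  {M : Type*} [TopologicalSpace M] [ChartedSpace E M] [IsManifold 𝓘(ℝ, E) ∞ M]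

/-- For a torsion-free connection, `∇_X Y - ∇_Y X` is the Lie bracket of vector fields. -/
lemma bracket_conn [IsManifold 𝓘(ℝ, E) 2 M]
    (cov : CovariantDerivative 𝓘(ℝ, E) E (TangentSpace 𝓘(ℝ, E) : M → Type _))
    [cov.ContMDiffCovariantDerivative ∞] (hcov : cov.torsion = 0) (X Y : VF E M) :
    (conn cov).bracket X Y = bracketVF X Y := by
  ext x
  exact cov.torsion_eq_zero_iff.mp hcov X.mdifferentiableAt Y.mdifferentiableAt

lemma bracketVF_jacobi (X Y Z : VF E M) : bracketVF X (bracketVF Y Z) =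
    bracketVF (bracketVF X Y) Z + bracketVF Y (bracketVF X Z) := by
  have : IsManifold 𝓘(ℝ, E) (minSmoothness ℝ 3) M :=
    IsManifold.of_le (n := ∞) minSmoothness_three_le
  ext x
  exact leibniz_identity_mlieBracket_apply
    ((X.contMDiff x).of_le minSmoothness_two_le) ((Y.contMDiff x).of_le minSmoothness_two_le)
    ((Z.contMDiff x).of_le minSmoothness_two_le)

end ManifoldInput

end Fedosov

end

theorem theorem2 {d : ℕ} {M : Type*} [TopologicalSpace M] [T2Space M]
    [ChartedSpace (EuclideanSpace ℝ (Fin d)) M]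
    [IsManifold 𝓘(ℝ, EuclideanSpace ℝ (Fin d)) ∞ M]
    (cov : CovariantDerivative 𝓘(ℝ, EuclideanSpace ℝ (Fin d)) (EuclideanSpace ℝ (Fin d))
      (TangentSpace 𝓘(ℝ, EuclideanSpace ℝ (Fin d)) : M → Type _))
    [cov.ContMDiffCovariantDerivative ∞] (hcov : cov.torsion = 0) :
    ∃ A : Fedosov.OmegaVect (EuclideanSpace ℝ (Fin d)) M 1,
      -- for every starting point, the iterates converge to `A`: in each degree `p` in `y` they are
      -- eventually equal to `A`
      (∀ A₀ : Fedosov.OmegaVect (EuclideanSpace ℝ (Fin d)) M 1, ∀ p : ℕ,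
        ∀ᶠ n in Filter.atTop, ∀ X : Fin 1 → Fedosov.VF (EuclideanSpace ℝ (Fin d)) M,
          ((Fedosov.fedosovStep (Fedosov.conn cov)
            (Fedosov.curvatureTwoForm (Fedosov.conn cov)))^[n] A₀) X p = A X p) ∧
      -- `A = δ⁻¹ R + δ⁻¹ (∇ A + ½ [A, A])`
      A = Fedosov.fedosovStep (Fedosov.conn cov)
        (Fedosov.curvatureTwoForm (Fedosov.conn cov)) A ∧
      -- the expansion of `A` in `y` starts in degree `2`
      (∀ X : Fin 1 → Fedosov.VF (EuclideanSpace ℝ (Fin d)) M, A X 0 = 0 ∧ A X 1 = 0) ∧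
      Fedosov.deltaInv A = 0 ∧
      -- `D² = 0` on `Ω(M, 𝒮M)`
      (∀ (q : ℕ) (a : Fedosov.OmegaS (EuclideanSpace ℝ (Fin d)) M q),
        Fedosov.fedosovD (Fedosov.conn cov) A (Fedosov.fedosovD (Fedosov.conn cov) A a) = 0) ∧
      -- `D` is an operator on forms with values in polyvector fields, and `D² = 0`
      (∀ (n q : ℕ), ∀ Φ ∈ Fedosov.OmegaTPoly (EuclideanSpace ℝ (Fin d)) M n q,
        Fedosov.fedosovDOp (Fedosov.conn cov) A Φ ∈
          Fedosov.OmegaTPoly (EuclideanSpace ℝ (Fin d)) M n (q + 1) ∧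
        Fedosov.fedosovDOp (Fedosov.conn cov) A (Fedosov.fedosovDOp (Fedosov.conn cov) A Φ) = 0) ∧
      -- `D` is an operator on forms with values in polydifferential operators, and `D² = 0`
      (∀ (n q : ℕ), ∀ Φ ∈ Fedosov.OmegaDPoly (EuclideanSpace ℝ (Fin d)) M n q,
        Fedosov.fedosovDOp (Fedosov.conn cov) A Φ ∈
          Fedosov.OmegaDPoly (EuclideanSpace ℝ (Fin d)) M n (q + 1) ∧
        Fedosov.fedosovDOp (Fedosov.conn cov) A (Fedosov.fedosovDOp (Fedosov.conn cov) A Φ) = 0) := by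
  have hJ : ∀ X Y Z, (Fedosov.conn cov).bracket X ((Fedosov.conn cov).bracket Y Z) =
      (Fedosov.conn cov).bracket ((Fedosov.conn cov).bracket X Y) Z +
        (Fedosov.conn cov).bracket Y ((Fedosov.conn cov).bracket X Z) := by
    intro X Y Z
    simp only [Fedosov.bracket_conn cov hcov]
    exact Fedosov.bracketVF_jacobi X Y Z
  have hK : ∀ X Y Z, Fedosov.curvature (Fedosov.conn cov) X Y Z =
      (Fedosov.conn cov).curv (Fedosov.conn cov) X Y Z := by
    intro X Y Z
    rw [Fedosov.Connection.curv, Fedosov.bracket_conn cov hcov]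
    rfl
  have hdir : ∀ X Y f, (Fedosov.conn cov).curv
      (Fedosov.Connection.trivial (Fedosov.dir (EuclideanSpace ℝ (Fin d)) M)) X Y f = 0 := by
    intro X Y f
    rw [Fedosov.Connection.curv, Fedosov.bracket_conn cov hcov]
    exact sub_eq_zero.mpr (Fedosov.dir_bracketVF X Y f).symm
  have hK0 := Fedosov.curvature_self (Fedosov.conn cov)
  refine ⟨Fedosov.fedosovLimit (Fedosov.conn cov)
    (Fedosov.curvatureTwoForm (Fedosov.conn cov)), ?_, ?_, ?_, ?_, ?_, ?_, ?_⟩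
  · intro A₀ p
    filter_upwards [Filter.eventually_ge_atTop (p + 1)] with n hn X
    obtain ⟨m, rfl⟩ : ∃ m, n = m + 1 := ⟨n - 1, by omega⟩
    exact Fedosov.iterate_fedosovStep _ _ A₀ m X p (by omega)
  · exact (Fedosov.fedosovStep_fedosovLimit _ _).symm
  · exact fun X => ⟨rfl, Fedosov.fedosovLimit_one_degree _ hK0 X⟩
  · exact Fedosov.deltaInv_fedosovLimit _ _
  · exact fun q a => Fedosov.fedosovD_fedosovD _ hK0 hK hJ hdir a
  · exact fun n q Φ hΦ => ⟨Fedosov.fedosovDOp_mem_polyVector _ _ Φ hΦ,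
      Fedosov.fedosovDOp_fedosovDOp _ hK0 hK hJ hdir Φ⟩
  · exact fun n q Φ hΦ => ⟨Fedosov.fedosovDOp_mem_polyDiffOp _ _ Φ hΦ,
      Fedosov.fedosovDOp_fedosovDOp _ hK0 hK hJ hdir Φ⟩
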